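/- Let $p$ be a prime, and let $\Gamma_p:\mathbb{Z}_p\to\mathbb{Z}_p$ be Morita's $p$-adic Gamma function, $\Gamma_p(x)=\lim_{n\to x}(-1)^n\prod_{1\le j<n,\ p\nmid j}j$, the limit being over natural numbers $n$ tending to $x$ $p$-adically. Let $\omega:\mathbb{F}_p^\times\to\mathbb{C}_p^\times$ be the Teichmüller character. Let $\theta:\mathbb{F}_p\to\mathbb{C}_p^\times$ be any non-trivial additive character, and for a multiplicative character $\chi$ of $\mathbb{F}_p$ (extended by $\chi(0)=0$, also when $\chi$ is trivial) let $g(\chi)=\sum_{x\in\mathbb{F}_p}\chi(x)\theta(x)$. For $d\ge1$ prime to $p$ put $$S_d(\chi)=g(\chi^{-1})^{\varphi(d)}\prod_{n\mid d}\bigl(g(\chi^n)\,\chi(n^{-n})\bigr)^{\mu(d/n)},\qquad \Sigma_d=\{\ell/d:\ 0<\ell\le d,\ \gcd(\ell,d)=1\}.$$ Let $\lambda\in\mathbb{Q}^\times$. Let $\alpha=\{\alpha_1,\dots,\alpha_m\}$ be a multiset of rational numbers with $0<\alpha_j\le1$, closed under Galois conjugation, that is, $\prod_{j=1}^m(x-e^{2\pi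 i\alpha_j})\in\mathbb{Z}[x]$; then $\alpha=\bigcup_{i=1}^t\Sigma_{d_i}$ for a unique multiset $\{d_1,\dots,d_t\}$ of positive integers. Let $\beta=\{1,\dots,1\}$ ($m$ entries), and assume that the data are primitive: $\alpha_j-\beta_\ell\notin\mathbb{Z}$ for all $j,\ell$. Assume that $p$ does not divide the least common denominator of $\alpha_1,\dots,\alpha_m$. Define the finite hypergeometric sum $$H_p(\alpha,\beta;\lambda)=\frac1{1-p}\sum_{k=0}^{p-2}\ \prod_{i=1}^t S_{d_i}(\omega^k)\ \,\omega^k\bigl((-1)^m\lambda\bigr),$$ where $\omega^k((-1)^m\lambda)$ is evaluated at the reduction of $(-1)^m\lambda$ modulo $p$ and is read as $0$ if $p$ divides the numerator or the denominator of $\lambda$. Then $$H_p(\alpha,\beta;\lambda)=\frac1{\prod_{j=1}^m\Gamma_p(\alpha_j)}\,\frac1{1-p}\sum_{k=0}^{p-2}\frac{\prod_{j=1}^m\Gamma_p\bigl(\bigl\{\alpha_j-\frac k{p-1}\bigr\}\bigr)}{\Gamma_p\bigl(1-\frac k{p-1}\bigr)^m}\,(-1)^{km}(-p)^{\nu_\alpha(k)}\,\omega^k\bigl((-1)^m\lambda\bigr),$$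 where $\{x\}=x-\lfloor x\rfloor$ is the fractional part and $\nu_\alpha(k)=\sum_{j=1}^m\nu(k,\alpha_j(p-1))$ with $\nu(a,x)=-\bigl\lfloor\frac{x-a}{p-1}\bigr\rfloor$. -/

import Mathlib

/-- The values at natural numbers of the `p`-adic Gamma function:
`Γ_p(n) = (-1)^n ∏_{1 ≤ j < n, p ∤ j} j`. -/
noncomputable def padicGammaNat (p : ℕ) [Fact p.Prime] (n : ℕ) : ℤ_[p] :=
  (-1) ^ n * ∏ j ∈ (Finset.Ico 1 n).filter (fun j => ¬ p ∣ j), (j : ℤ_[p])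

/-- Morita's `p`-adic Gamma function on `ℤ_p`: `Γ_p(x)` is the limit of `Γ_p(n)` as the natural
number `n` tends to `x` in the `p`-adic topology. -/
noncomputable def padicGamma (p : ℕ) [Fact p.Prime] (x : ℤ_[p]) : ℤ_[p] :=
  Filter.limUnder (Filter.comap (fun n : ℕ => (n : ℤ_[p])) (nhds x)) (padicGammaNat p)

open scoped Classical in
/-- A rational number, viewed as a `p`-adic integer. The value is meaningful only when `p` does
not divide the denominator of `r`, and it is `0` otherwise. -/
noncomputable def ratToPadicInt (p : ℕ) [Fact p.Prime] (r : ℚ) : ℤ_[p] :=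
  if h : ‖(r : ℚ_[p])‖ ≤ 1 then ⟨(r : ℚ_[p]), h⟩ else 0

/-- The `p`-adic Gamma function at a `p`-integral rational number, as an element of `ℂ_p`. -/
noncomputable def padicGammaRat (p : ℕ) [Fact p.Prime] (r : ℚ) : ℂ_[p] :=
  algebraMap ℚ_[p] ℂ_[p] (padicGamma p (ratToPadicInt p r) : ℚ_[p])

/-- The Teichmüller lift `𝔽_p → ℤ_p`, obtained from the Teichmüller lift to Witt vectors
and the isomorphism `W(𝔽_p) ≃ ℤ_p`. -/
noncomputable def teichmullerLift (p : ℕ) [Fact p.Prime] : ZMod p →* ℤ_[p] :=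
  ((WittVector.equiv p : WittVector p (ZMod p) ≃+* ℤ_[p]) :
    WittVector p (ZMod p) →* ℤ_[p]).comp (WittVector.teichmuller p)

theorem teichmullerLift_zero (p : ℕ) [Fact p.Prime] : teichmullerLift p 0 = 0 := by
  simp [teichmullerLift]

theorem toZMod_teichmullerLift (p : ℕ) [Fact p.Prime] (x : ZMod p) :
    PadicInt.toZMod (teichmullerLift p x) = x := by
  let g : ℤ_[p] →+* ZMod p :=
    WittVector.constantCoeff.comp (WittVector.equiv p).symm.toRingHom
  have hg : g (teichmullerLift p x) = x := by
    simp [g, teichmullerLift, WittVector.constantCoeff]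
  have key : ∀ y : ℤ_[p], PadicInt.toZMod y = g y := by
    intro y
    have h := PadicInt.toZMod_spec y
    rw [PadicInt.maximalIdeal_eq_span_p, Ideal.mem_span_singleton] at h
    obtain ⟨z, hz⟩ := h
    have h2 : y = (ZMod.cast (PadicInt.toZMod y) : ℤ_[p]) + p * z := by rw [← hz]; ring
    have h3 : (ZMod.cast (PadicInt.toZMod y) : ℤ_[p]) = ((PadicInt.toZMod y).val : ℤ_[p]) := by
      rw [ZMod.natCast_val]
    rw [h3] at h2
    have h4 : g y = ((PadicInt.toZMod y).val : ZMod p) + (p : ZMod p) * g z := by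
      rw [← map_natCast g, ← map_natCast g p, ← map_mul, ← map_add, ← h2]
    rw [h4, ZMod.natCast_zmod_val, CharP.cast_eq_zero, zero_mul, add_zero]
  rw [key, hg]

/-- The Teichmüller character `ω` of `𝔽_p^×` with values in `ℂ_p`, extended by `ω(0) = 0`. -/
noncomputable def teichmullerChar (p : ℕ) [Fact p.Prime] : MulChar (ZMod p) ℂ_[p] where
  toFun x := algebraMap ℚ_[p] ℂ_[p] (teichmullerLift p x : ℚ_[p])
  map_one' := by simp
  map_mul' x y := by simp
  map_nonunit' x hx := by
    have h : x = 0 := by simpa [isUnit_iff_ne_zero] using hx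
    simp [h, teichmullerLift_zero]

/-- The multiset `α` of rational numbers is closed under Galois conjugation:
`∏ (x - e^{2πiα_j})` has integer coefficients. -/
def IsGaloisClosed (α : Multiset ℚ) : Prop :=
  ∃ P : Polynomial ℤ, P.map (Int.castRingHom ℂ) =
    (α.map fun a : ℚ => Polynomial.X -
      Polynomial.C (Complex.exp (2 * Real.pi * Complex.I * (a : ℂ)))).prod

/-- The hypergeometric data `α`, `β` are primitive: no difference `α_j - β_l` is an integer. -/
def IsPrimitiveData (α β : Multiset ℚ) : Prop :=
  ∀ a ∈ α, ∀ b ∈ β, ∀ n : ℤ, a - b ≠ (n : ℚ)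

/-- The multiset `Σ_d = {l / d : 0 < l ≤ d, gcd(l, d) = 1}`. -/
def reducedFractions (d : ℕ) : Multiset ℚ :=
  ((Finset.Icc 1 d).filter fun l => Nat.Coprime l d).val.map fun l : ℕ => (l : ℚ) / (d : ℚ)

/-- The multiset `{d_1, …, d_t}` of those `d` for which `α` is the union of the `Σ_{d_i}`. Since
`1/d` belongs to `Σ_d` and to no other `Σ_{d'}`, the multiplicity of `d` is that of `1/d` in `α`;
see `cyclotomicIndices_eq`. -/
def cyclotomicIndices (α : Multiset ℚ) : Multiset ℕ :=
  (α.filter fun a : ℚ => a.num = 1).map Rat.den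

theorem cyclotomicIndices_reducedFractions {d : ℕ} (hd : 0 < d) :
    cyclotomicIndices (reducedFractions d) = {d} := by
  have hnd : ∀ l : ℕ, Nat.Coprime l d →
      ((l : ℚ) / (d : ℚ)).num = l ∧ ((l : ℚ) / (d : ℚ)).den = d := by
    intro l hl
    have h1 := Rat.num_div_eq_of_coprime (a := (l : ℤ)) (b := (d : ℤ)) (by exact_mod_cast hd)
      (by simpa using hl)
    have h2 := Rat.den_div_eq_of_coprime (a := (l : ℤ)) (b := (d : ℤ)) (by exact_mod_cast hd)
      (by simpa using hl)
    simp only [Int.cast_natCast] at h1 h2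
    exact ⟨h1, Nat.cast_injective (R := ℤ) h2⟩
  have hf : ((Finset.Icc 1 d).filter fun l => Nat.Coprime l d).val.filter
      (fun l : ℕ => ((l : ℚ) / (d : ℚ)).num = 1) = {1} := by
    rw [← Finset.filter_val]
    have : (((Finset.Icc 1 d).filter fun l => Nat.Coprime l d).filter
      (fun l : ℕ => ((l : ℚ) / (d : ℚ)).num = 1)) = {1} := by
      ext l
      simp only [Finset.mem_filter, Finset.mem_Icc, Finset.mem_singleton]
      constructor
      · rintro ⟨⟨_, hl⟩, h⟩
        rw [(hnd l hl).1] at h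
        exact_mod_cast h
      · rintro rfl
        exact ⟨⟨⟨le_refl _, hd⟩, Nat.coprime_one_left d⟩,
          by simpa using (hnd 1 (Nat.coprime_one_left d)).1⟩
    rw [this]; rfl
  rw [cyclotomicIndices, reducedFractions, Multiset.filter_map]
  have hf' : Multiset.filter ((fun a : ℚ => a.num = 1) ∘ fun l : ℕ => (l : ℚ) / (d : ℚ))
      ((Finset.Icc 1 d).filter fun l => Nat.Coprime l d).val = {1} := hf
  rw [hf']
  simpa using (hnd 1 (Nat.coprime_one_left d)).2

theorem cyclotomicIndices_eq (D : Multiset ℕ) (hD : ∀ d ∈ D, 0 < d) :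
    cyclotomicIndices (D.map reducedFractions).sum = D := by
  induction D using Multiset.induction_on with
  | empty => simp [cyclotomicIndices]
  | cons d D ih =>
    have h1 := cyclotomicIndices_reducedFractions (hD d (Multiset.mem_cons_self d D))
    have h2 := ih fun e he => hD e (Multiset.mem_cons_of_mem he)
    rw [Multiset.map_cons, Multiset.sum_cons]
    unfold cyclotomicIndices at *
    rw [Multiset.filter_add, Multiset.map_add, h1, h2, Multiset.singleton_add]

section FiniteField

variable {F K : Type*} [Field F] [Fintype F] [Field K]

/-- The character sum
`S_d(χ) = g(χ⁻¹)^{φ(d)} ∏_{n ∣ d} (g(χ^n) χ(n^{-n}))^{μ(d/n)}`,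
where `g(χ) = ∑ x, χ(x) θ(x)` is the Gauss sum. -/
noncomputable def gaussSumS (θ : AddChar F K) (d : ℕ) (χ : MulChar F K) : K :=
  gaussSum χ⁻¹ θ ^ Nat.totient d *
    ∏ n ∈ d.divisors,
      (gaussSum (χ ^ n) θ * χ ((n : F) ^ (-(n : ℤ)))) ^ (ArithmeticFunction.moebius (d / n))

/-- The finite hypergeometric sum over `F`, `q = #F`, for the data `α = ⋃ Σ_{d_i}` with `m`
elements, `β = {1, …, 1}` and `lam`:
`H_q(α, β; lam) = 1/(1-q) ∑_{k=0}^{q-2} ∏_i S_{d_i}(ω^k) ω^k((-1)^m lam)`. -/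
noncomputable def finiteHypergeometricSum (θ : AddChar F K) (ω : MulChar F K)
    (α : Multiset ℚ) (lam : F) : K :=
  1 / (1 - (Fintype.card F : K)) *
    ∑ k ∈ Finset.range (Fintype.card F - 1),
      ((cyclotomicIndices α).map fun d : ℕ => gaussSumS θ d (ω ^ k)).prod *
        (ω ^ k) ((-1) ^ Multiset.card α * lam)

end FiniteField

/-- `ν(a, x) = -⌊(x - a)/(p - 1)⌋`. -/
def hypNu (p : ℕ) (a x : ℚ) : ℤ := -⌊(x - a) / ((p : ℚ) - 1)⌋

/-- `ν_α(k) = ∑_j ν(k, α_j (p - 1))`. -/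
def hypNuMultiset (p : ℕ) (α : Multiset ℚ) (k : ℕ) : ℤ :=
  (α.map fun a : ℚ => hypNu p k (a * ((p : ℚ) - 1))).sum

section GammaFunction

variable (p : ℕ) [hp : Fact p.Prime]

open Classical in
/-- The factor in the functional equation of the `p`-adic Gamma function: `-x` for units and `-1`
otherwise. -/
noncomputable def gammaStep (x : ℤ_[p]) : ℤ_[p] := if IsUnit x then -x else -1

theorem gammaStep_of_isUnit {x : ℤ_[p]} (hx : IsUnit x) : gammaStep p x = -x := if_pos hx

theorem gammaStep_of_not_isUnit {x : ℤ_[p]} (hx : ¬ IsUnit x) : gammaStep p x = -1 := if_neg hx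

theorem PadicInt.isUnit_natCast_iff (n : ℕ) : IsUnit (n : ℤ_[p]) ↔ ¬ p ∣ n := by
  have h1 := PadicInt.norm_int_lt_one_iff_dvd (p := p) n
  rw [Int.natCast_dvd_natCast, Int.cast_natCast] at h1
  rw [PadicInt.isUnit_iff, ← h1, not_lt]
  exact ⟨fun h => h.ge, fun h => le_antisymm (PadicInt.norm_le_one _) h⟩

theorem isUnit_gammaStep (x : ℤ_[p]) : IsUnit (gammaStep p x) := by
  by_cases hx : IsUnit x
  · rw [gammaStep_of_isUnit p hx]; exact hx.neg
  · rw [gammaStep_of_not_isUnit p hx]; exact isUnit_one.neg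

theorem padicGammaNat_zero : padicGammaNat p 0 = 1 := by simp [padicGammaNat]

theorem padicGammaNat_succ (n : ℕ) :
    padicGammaNat p (n + 1) = gammaStep p n * padicGammaNat p n := by
  by_cases hn : p ∣ n
  · rw [gammaStep_of_not_isUnit p (by simpa [PadicInt.isUnit_natCast_iff] using hn)]
    rcases Nat.eq_zero_or_pos n with rfl | h0
    · simp [padicGammaNat]
    · simp only [padicGammaNat]
      rw [← Finset.insert_Ico_right_eq_Ico_add_one (by omega : 1 ≤ n), Finset.filter_insert,
        if_neg (not_not.mpr hn), pow_succ]
      ring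
  · rw [gammaStep_of_isUnit p (by simpa [PadicInt.isUnit_natCast_iff] using hn)]
    have h0 : 1 ≤ n := Nat.one_le_iff_ne_zero.mpr fun h => hn (h ▸ dvd_zero p)
    simp only [padicGammaNat]
    rw [← Finset.insert_Ico_right_eq_Ico_add_one h0, Finset.filter_insert, if_pos hn, pow_succ,
      Finset.prod_insert (by simp)]
    ring

theorem isUnit_padicGammaNat (n : ℕ) : IsUnit (padicGammaNat p n) := by
  induction n with
  | zero => simp [padicGammaNat_zero]
  | succ n ih => rw [padicGammaNat_succ]; exact (isUnit_gammaStep p _).mul ih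

theorem padicGammaNat_add (n m : ℕ) : padicGammaNat p (n + m) =
    padicGammaNat p n * ∏ j ∈ Finset.range m, gammaStep p (n + j : ℕ) := by
  induction m with
  | zero => simp
  | succ m ih => rw [← add_assoc, padicGammaNat_succ, ih, Finset.prod_range_succ]; ring

open Classical in
/-- The product of the reductions of the factors in the functional equation over `ℤ / p ^ N`. -/
noncomputable def gammaPeriod (N : ℕ) : ZMod (p ^ N) :=
  ∏ x : ZMod (p ^ N), if IsUnit x then -x else -1

theorem gammaPeriod_sq (N : ℕ) : gammaPeriod p N ^ 2 = 1 := by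
  classical
  let e : ZMod (p ^ N) ≃ ZMod (p ^ N) := Function.Involutive.toPerm
    (fun x => if IsUnit x then Ring.inverse x else x) (by
      intro x
      by_cases hx : IsUnit x
      · simp [hx, Ring.inverse_inverse]
      · simp [hx])
  have h : gammaPeriod p N = ∏ x : ZMod (p ^ N), if IsUnit (e x) then -(e x) else -1 :=
    (Equiv.prod_comp e _).symm
  rw [sq]
  nth_rw 2 [h]
  rw [gammaPeriod, ← Finset.prod_mul_distrib]
  refine Finset.prod_eq_one fun x _ => ?_
  have he : e x = if IsUnit x then Ring.inverse x else x := rfl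
  by_cases hx : IsUnit x
  · have hx' : IsUnit (Ring.inverse x) := hx.ringInverse
    rw [he]
    simp only [hx, if_true, hx', neg_mul_neg]
    exact Ring.mul_inverse_cancel x hx
  · rw [he]; simp [hx]

theorem toZModPow_gammaStep_natCast {N : ℕ} (hN : N ≠ 0) (n : ℕ) [Decidable (IsUnit (n : ZMod (p ^ N)))] :
    PadicInt.toZModPow N (gammaStep p n) =
      if IsUnit (n : ZMod (p ^ N)) then -(n : ZMod (p ^ N)) else -1 := by
  have h : IsUnit (n : ℤ_[p]) ↔ IsUnit (n : ZMod (p ^ N)) := by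
    rw [PadicInt.isUnit_natCast_iff, ZMod.isUnit_iff_coprime,
      Nat.coprime_pow_right_iff (Nat.pos_of_ne_zero hN), Nat.coprime_comm,
      hp.out.coprime_iff_not_dvd]
  by_cases hn : IsUnit (n : ZMod (p ^ N))
  · rw [gammaStep_of_isUnit p (h.mpr hn), if_pos hn, map_neg, map_natCast]
  · rw [gammaStep_of_not_isUnit p (fun h' => hn (h.mp h')), if_neg hn, map_neg, map_one]

theorem prod_range_natCast_zmod {R : Type*} [CommMonoid R] (M : ℕ) [NeZero M] (n : ℕ)
    (f : ZMod M → R) : ∏ j ∈ Finset.range M, f ((n + j : ℕ) : ZMod M) = ∏ x, f x := by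
  refine Finset.prod_bij' (fun j _ => ((n + j : ℕ) : ZMod M)) (fun x _ => (x - n).val)
    (by simp) (fun x _ => by simpa using ZMod.val_lt (x - (n : ZMod M))) ?_ ?_ (by simp)
  · intro j hj
    simp [ZMod.val_natCast, Nat.mod_eq_of_lt (Finset.mem_range.mp hj)]
  · intro x _
    simp

theorem toZModPow_padicGammaNat_add_mul {N : ℕ} (hN : N ≠ 0) (n m : ℕ) :
    PadicInt.toZModPow N (padicGammaNat p (n + p ^ N * m)) =
      PadicInt.toZModPow N (padicGammaNat p n) * gammaPeriod p N ^ m := by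
  classical
  induction m with
  | zero => simp
  | succ m ih =>
    rw [mul_add, mul_one, ← add_assoc, padicGammaNat_add, map_mul, ih, map_prod, pow_succ,
      ← mul_assoc]
    congr 1
    have : NeZero (p ^ N) := ⟨pow_ne_zero _ hp.out.ne_zero⟩
    rw [gammaPeriod, ← prod_range_natCast_zmod (p ^ N) (n + p ^ N * m)]
    exact Finset.prod_congr rfl fun j _ => toZModPow_gammaStep_natCast p hN _

theorem gammaPeriod_eq {N : ℕ} (hN : N ≠ 0) :
    gammaPeriod p N = PadicInt.toZModPow N (padicGammaNat p (p ^ N)) := by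
  have := toZModPow_padicGammaNat_add_mul p hN 0 1
  simpa [padicGammaNat_zero] using this.symm

theorem padicGammaNat_prime_sub_one_mem (h2 : p ≠ 2) :
    PadicInt.toZModPow 1 (padicGammaNat p p) = 1 := by
  have hp1 := hp.out.one_le
  have hf : (Finset.Ico 1 p).filter (fun j => ¬ p ∣ j) = Finset.Ico 1 p := by
    refine Finset.filter_true_of_mem fun j hj => ?_
    rw [Finset.mem_Ico] at hj
    exact Nat.not_dvd_of_pos_of_lt hj.1 hj.2
  have hw : ((p - 1).factorial : ZMod (p ^ 1)) = -1 := by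
    have h := ZMod.wilsons_lemma p
    have h3 : ((p : ℕ) : ℤ) ∣ ((p - 1).factorial : ℤ) + 1 := by
      rw [← ZMod.intCast_zmod_eq_zero_iff_dvd _ p]
      push_cast
      rw [h]; ring
    have h4 : (((p - 1).factorial : ℤ) + 1 : ℤ) = (0 : ZMod (p ^ 1)) := by
      rw [ZMod.intCast_zmod_eq_zero_iff_dvd]; simpa using h3
    push_cast at h4
    exact eq_neg_of_add_eq_zero_left h4
  have hfac : ∏ j ∈ Finset.Ico 1 p, j = (p - 1).factorial := by
    rw [← Finset.prod_Ico_id_eq_factorial, Nat.sub_add_cancel hp1]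
  rw [padicGammaNat, hf, ← Nat.cast_prod, hfac]
  simp only [map_mul, map_pow, map_neg, map_one, map_natCast, hw]
  rw [(hp.out.odd_of_ne_two h2).neg_one_pow]
  ring

theorem gammaPeriod_pow_prime (N : ℕ) : gammaPeriod p N ^ p = 1 := by
  rcases eq_or_ne N 0 with rfl | hN
  · have : Subsingleton (ZMod (p ^ 0)) := by rw [pow_zero]; infer_instance
    exact Subsingleton.elim _ _
  have hsq := gammaPeriod_sq p N
  rcases eq_or_ne p 2 with h2 | h2
  · have : gammaPeriod p N ^ p = gammaPeriod p N ^ 2 := congrArg _ h2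
    rw [this, hsq]
  set G := padicGammaNat p (p ^ N) with hG
  have h1 : PadicInt.toZModPow 1 G = 1 := by
    obtain ⟨M, rfl⟩ := Nat.exists_eq_succ_of_ne_zero hN
    have h := toZModPow_padicGammaNat_add_mul p one_ne_zero 0 (p ^ M)
    have h0 : PadicInt.toZModPow 1 (padicGammaNat p (p ^ 1)) = 1 := by
      have h1 := padicGammaNat_prime_sub_one_mem p h2
      rwa [← congrArg (padicGammaNat p) (pow_one p)] at h1
    rw [gammaPeriod_eq p one_ne_zero, h0, zero_add,
      padicGammaNat_zero, map_one, one_pow, one_mul] at h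
    refine Eq.trans ?_ h
    exact congrArg (fun a => PadicInt.toZModPow 1 (padicGammaNat p a)) (by rw [pow_one, pow_succ'])
  have hnorm : ∀ (n : ℕ) (x : ℤ_[p]), PadicInt.toZModPow n x = 0 ↔ (p : ℤ_[p]) ^ n ∣ x := by
    intro n x
    rw [← RingHom.mem_ker, PadicInt.ker_toZModPow, Ideal.mem_span_singleton]
  have hu : IsUnit (G + 1) := by
    by_contra hu
    rw [PadicInt.isUnit_iff] at hu
    have hlt : ‖G + 1‖ < 1 := lt_of_le_of_ne (PadicInt.norm_le_one _) hu
    rw [PadicInt.norm_lt_one_iff_dvd] at hlt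
    have h3 : PadicInt.toZModPow 1 (G + 1) = 0 := (hnorm 1 _).mpr (by simpa using hlt)
    rw [map_add, h1, map_one] at h3
    have h4 : ((2 : ℕ) : ZMod (p ^ 1)) = 0 := by push_cast; rw [← h3]; ring
    rw [ZMod.natCast_eq_zero_iff, pow_one] at h4
    exact h2 ((Nat.prime_dvd_prime_iff_eq hp.out Nat.prime_two).mp h4)
  have h5 : gammaPeriod p N = 1 := by
    have h6 : PadicInt.toZModPow N ((G - 1) * (G + 1)) = 0 := by
      rw [map_mul, map_sub, map_add, map_one, hG, ← gammaPeriod_eq p hN]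
      linear_combination hsq
    rw [hnorm, hu.dvd_mul_right, ← hnorm, map_sub, map_one, hG, ← gammaPeriod_eq p hN] at h6
    exact sub_eq_zero.mp h6
  rw [h5, one_pow]

theorem norm_padicGammaNat_sub_le_of_le {N m n : ℕ} (hmn : m ≤ n)
    (h : ‖(n : ℤ_[p]) - m‖ ≤ (p : ℝ) ^ (-(N + 1 : ℕ) : ℤ)) :
    ‖padicGammaNat p n - padicGammaNat p m‖ ≤ (p : ℝ) ^ (-N : ℤ) := by
  have h1 : (p : ℤ) ^ (N + 1) ∣ ((n : ℤ) - m) := by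
    rw [← PadicInt.norm_int_le_pow_iff_dvd]; simpa using h
  obtain ⟨c, hc⟩ : p ^ (N + 1) ∣ n - m := by
    rw [← Nat.cast_sub hmn] at h1; exact_mod_cast h1
  have hn : n = m + p ^ N * (p * c) := by rw [← mul_assoc, ← pow_succ, ← hc]; omega
  rw [PadicInt.norm_le_pow_iff_mem_span_pow, ← PadicInt.ker_toZModPow, RingHom.mem_ker, map_sub]
  rcases eq_or_ne N 0 with rfl | hN
  · have : Subsingleton (ZMod (p ^ 0)) := by rw [pow_zero]; infer_instance
    exact Subsingleton.elim _ _
  · rw [hn, toZModPow_padicGammaNat_add_mul p hN, pow_mul, gammaPeriod_pow_prime, one_pow, mul_one,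
      sub_self]

theorem norm_padicGammaNat_sub_le {N m n : ℕ}
    (h : ‖(n : ℤ_[p]) - m‖ ≤ (p : ℝ) ^ (-(N + 1 : ℕ) : ℤ)) :
    ‖padicGammaNat p n - padicGammaNat p m‖ ≤ (p : ℝ) ^ (-N : ℤ) := by
  rcases le_total m n with hmn | hmn
  · exact norm_padicGammaNat_sub_le_of_le p hmn h
  · rw [norm_sub_rev] at h ⊢
    exact norm_padicGammaNat_sub_le_of_le p hmn h

theorem eventually_norm_natCast_sub_le (x : ℤ_[p]) (N : ℕ) :
    ∀ᶠ n : ℕ in Filter.comap (fun n : ℕ => (n : ℤ_[p])) (nhds x),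
      ‖(n : ℤ_[p]) - x‖ ≤ (p : ℝ) ^ (-N : ℤ) := by
  have h : ∀ᶠ y in nhds x, ‖y - x‖ ≤ (p : ℝ) ^ (-N : ℤ) := by
    have h0 : (0 : ℝ) < (p : ℝ) ^ (-N : ℤ) := zpow_pos (by exact_mod_cast hp.out.pos) _
    filter_upwards [Metric.closedBall_mem_nhds x h0] with y hy
    rwa [Metric.mem_closedBall, dist_eq_norm] at hy
  exact Filter.Eventually.comap h _

instance neBot_comap_natCast_nhds (x : ℤ_[p]) :
    (Filter.comap (fun n : ℕ => (n : ℤ_[p])) (nhds x)).NeBot :=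
  Filter.comap_neBot_iff.mpr fun _ ht => PadicInt.denseRange_natCast.mem_nhds ht

theorem PadicInt.norm_sub_le_of_le_of_le {x y z : ℤ_[p]} {r : ℝ} (h1 : ‖x - y‖ ≤ r)
    (h2 : ‖z - y‖ ≤ r) : ‖x - z‖ ≤ r := by
  have : x - z = (x - y) + (y - z) := by ring
  rw [this]
  refine (IsUltrametricDist.norm_add_le_max _ _).trans (max_le h1 ?_)
  rwa [norm_sub_rev]

theorem tendsto_padicGammaNat (x : ℤ_[p]) :
    Filter.Tendsto (padicGammaNat p) (Filter.comap (fun n : ℕ => (n : ℤ_[p])) (nhds x))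
      (nhds (padicGamma p x)) := by
  refine tendsto_nhds_limUnder (CompleteSpace.complete ?_)
  refine Metric.cauchy_iff.mpr ⟨inferInstance, fun ε hε => ?_⟩
  obtain ⟨N, hN⟩ := PadicInt.exists_pow_neg_lt p hε
  refine ⟨_, Filter.image_mem_map (eventually_norm_natCast_sub_le p x (N + 1)), ?_⟩
  rintro _ ⟨m, hm, rfl⟩ _ ⟨n, hn, rfl⟩
  rw [dist_eq_norm]
  exact (norm_padicGammaNat_sub_le p (PadicInt.norm_sub_le_of_le_of_le p hm hn)).trans_lt hN

theorem norm_padicGamma_sub_padicGammaNat_le {x : ℤ_[p]} {N n : ℕ}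
    (h : ‖(n : ℤ_[p]) - x‖ ≤ (p : ℝ) ^ (-(N + 1 : ℕ) : ℤ)) :
    ‖padicGamma p x - padicGammaNat p n‖ ≤ (p : ℝ) ^ (-N : ℤ) := by
  refine le_of_tendsto ((tendsto_padicGammaNat p x).sub_const _).norm ?_
  filter_upwards [eventually_norm_natCast_sub_le p x (N + 1)] with m hm
  exact norm_padicGammaNat_sub_le p (PadicInt.norm_sub_le_of_le_of_le p hm h)

theorem norm_padicGamma_sub_le {x y : ℤ_[p]} {N : ℕ}
    (h : ‖x - y‖ ≤ (p : ℝ) ^ (-(N + 1 : ℕ) : ℤ)) :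
    ‖padicGamma p x - padicGamma p y‖ ≤ (p : ℝ) ^ (-N : ℤ) := by
  obtain ⟨n, hn⟩ := (eventually_norm_natCast_sub_le p y (N + 1)).exists
  have hn' : ‖(n : ℤ_[p]) - x‖ ≤ (p : ℝ) ^ (-(N + 1 : ℕ) : ℤ) :=
    PadicInt.norm_sub_le_of_le_of_le p hn h
  refine PadicInt.norm_sub_le_of_le_of_le p (norm_padicGamma_sub_padicGammaNat_le p hn')
    (norm_padicGamma_sub_padicGammaNat_le p hn)

theorem continuous_padicGamma : Continuous (padicGamma p) := by
  refine Metric.continuous_iff.mpr fun x ε hε => ?_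
  obtain ⟨N, hN⟩ := PadicInt.exists_pow_neg_lt p hε
  refine ⟨(p : ℝ) ^ (-(N + 1 : ℕ) : ℤ), zpow_pos (by exact_mod_cast hp.out.pos) _, fun y hy => ?_⟩
  rw [dist_eq_norm] at hy ⊢
  exact (norm_padicGamma_sub_le p hy.le).trans_lt hN

theorem padicGamma_natCast (n : ℕ) : padicGamma p n = padicGammaNat p n := by
  rw [← sub_eq_zero, ← norm_le_zero_iff]
  refine le_of_forall_gt fun ε hε => ?_
  obtain ⟨N, hN⟩ := PadicInt.exists_pow_neg_lt p hε
  refine (norm_padicGamma_sub_padicGammaNat_le p (N := N) ?_).trans_lt hN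
  rw [sub_self, norm_zero]
  exact (zpow_pos (by exact_mod_cast hp.out.pos) _).le

theorem padicGamma_zero : padicGamma p 0 = 1 := by
  simpa [padicGammaNat_zero] using padicGamma_natCast p 0

theorem isUnit_padicGamma (x : ℤ_[p]) : IsUnit (padicGamma p x) := by
  rw [PadicInt.isUnit_iff]
  refine tendsto_nhds_unique (tendsto_padicGammaNat p x).norm ?_
  simp only [PadicInt.isUnit_iff.mp (isUnit_padicGammaNat p _)]
  exact tendsto_const_nhds

theorem continuous_gammaStep : Continuous (gammaStep p) := by
  classical
  have h : IsClopen {x : ℤ_[p] | IsUnit x} := by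
    have : {x : ℤ_[p] | IsUnit x} = Metric.sphere 0 1 := by
      ext x; simp [PadicInt.isUnit_iff]
    rw [this]
    exact IsUltrametricDist.isClopen_sphere _ one_ne_zero
  exact Continuous.if (fun a ha => by simp [h.frontier_eq] at ha) continuous_neg continuous_const

theorem padicGamma_add_one (x : ℤ_[p]) :
    padicGamma p (x + 1) = gammaStep p x * padicGamma p x := by
  have h := DenseRange.equalizer (g := fun x : ℤ_[p] => padicGamma p (x + 1))
    (h := fun x => gammaStep p x * padicGamma p x) PadicInt.denseRange_natCast
    ((continuous_padicGamma p).comp (continuous_id.add continuous_const))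
    ((continuous_gammaStep p).mul (continuous_padicGamma p)) (funext fun n => by
      have := padicGamma_natCast p (n + 1)
      push_cast at this
      simp only [Function.comp_apply]
      rw [this, padicGammaNat_succ, padicGamma_natCast])
  exact congrFun h x

theorem padicGamma_one : padicGamma p 1 = -1 := by
  have h := padicGamma_add_one p 0
  rwa [zero_add, gammaStep_of_not_isUnit p not_isUnit_zero, padicGamma_zero, mul_one] at h

end GammaFunction

section StepFunctions

variable (p : ℕ)

theorem card_filter_not_dvd_range (n : ℕ) :
    ((Finset.range (n + 1)).filter fun j => ¬ p ∣ j).card = n - n / p := by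
  induction n with
  | zero => simp
  | succ n ih =>
    have hle := Nat.div_le_self n p
    rw [Finset.range_add_one, Finset.filter_insert, Nat.succ_div]
    split_ifs with h1
    · rw [ih]; omega
    · rw [Finset.card_insert_of_notMem (by simp), ih]; omega

variable [hp : Fact p.Prime]

theorem teichmullerLift_pow_prime_pow (x : ZMod p) (N : ℕ) :
    teichmullerLift p x ^ p ^ N = teichmullerLift p x := by
  rw [← map_pow, ZMod.pow_card_pow]

theorem prime_dvd_sub_teichmullerLift (c : ℤ_[p]) :
    (p : ℤ_[p]) ∣ c - teichmullerLift p (PadicInt.toZMod c) := by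
  rw [← Ideal.mem_span_singleton, ← PadicInt.maximalIdeal_eq_span_p, ← PadicInt.ker_toZMod,
    RingHom.mem_ker, map_sub, toZMod_teichmullerLift, sub_self]

theorem tendsto_prime_pow (p : ℕ) [hp : Fact p.Prime] :
    Filter.Tendsto (fun N : ℕ => (p : ℤ_[p]) ^ N) Filter.atTop (nhds 0) :=
  tendsto_pow_atTop_nhds_zero_of_norm_lt_one (by rw [PadicInt.norm_p]; exact inv_lt_one_of_one_lt₀ (by exact_mod_cast hp.out.one_lt))

theorem tendsto_pow_prime_pow (c : ℤ_[p]) : Filter.Tendsto (fun N : ℕ => c ^ p ^ N) Filter.atTop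
    (nhds (teichmullerLift p (PadicInt.toZMod c))) := by
  rw [← tendsto_sub_nhds_zero_iff]
  refine squeeze_zero_norm (fun N => ?_) (by simpa only [norm_zero] using (tendsto_prime_pow p).norm)
  have h := dvd_sub_pow_of_dvd_sub (prime_dvd_sub_teichmullerLift p c) N
  rw [teichmullerLift_pow_prime_pow] at h
  obtain ⟨z, hz⟩ := h
  rw [hz, norm_mul, pow_succ, norm_mul, mul_assoc]
  exact mul_le_of_le_one_right (norm_nonneg ((p : ℤ_[p]) ^ N))
    (mul_le_one₀ (PadicInt.norm_le_one (p : ℤ_[p])) (norm_nonneg _) (PadicInt.norm_le_one z))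

theorem isUnit_prime_sub_one : IsUnit ((p : ℤ_[p]) - 1) := by
  have h : ((p - 1 : ℕ) : ℤ_[p]) = (p : ℤ_[p]) - 1 := by
    rw [Nat.cast_sub hp.out.one_le, Nat.cast_one]
  rw [← h, PadicInt.isUnit_natCast_iff]
  have := hp.out.two_le
  exact Nat.not_dvd_of_pos_of_lt (by omega) (by omega)

theorem eval_natCast_of_step {f : ℤ_[p] → ℚ_[p]} {c : ℤ_[p]}
    (h1 : ∀ x, IsUnit x → f (x + 1) = c * f x) (h2 : ∀ x, ¬ IsUnit x → f (x + 1) = f x) (n : ℕ) :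
    f n = (c : ℚ_[p]) ^ ((Finset.range n).filter fun j => ¬ p ∣ j).card * f 0 := by
  induction n with
  | zero => simp
  | succ n ih =>
    rw [Finset.range_add_one, Finset.filter_insert, Nat.cast_add, Nat.cast_one]
    split_ifs with hn
    · rw [h2 _ (fun h => (PadicInt.isUnit_natCast_iff p n).mp h hn), ih]
    · rw [h1 _ ((PadicInt.isUnit_natCast_iff p n).mpr hn),
        Finset.card_insert_of_notMem (by simp), ih, pow_succ]
      ring

theorem eval_div_prime_sub_one_of_step {f : ℤ_[p] → ℚ_[p]} (hf : Continuous f) {c : ℤ_[p]}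
    (h1 : ∀ x, IsUnit x → f (x + 1) = c * f x) (h2 : ∀ x, ¬ IsUnit x → f (x + 1) = f x)
    {r : ℕ} (hr : r < p) {y : ℤ_[p]} (hy : ((p : ℤ_[p]) - 1) * y = r) :
    f y = (teichmullerLift p (PadicInt.toZMod c) : ℚ_[p]) ^ (p - 1 - r) * f 0 := by
  set q := p - 1 - r with hq
  let g : ℕ → ℕ := fun N => ∑ i ∈ Finset.range N, p ^ i
  let x : ℕ → ℕ := fun N => q * g (N + 1) + 1
  have hg : ∀ N, ((p : ℤ_[p]) - 1) * (g N : ℤ_[p]) = (p : ℤ_[p]) ^ N - 1 := by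
    intro N
    have := geom_sum_mul (p : ℤ_[p]) N
    simp only [g]
    push_cast
    rw [mul_comm, this]
  have hqr : (q : ℤ_[p]) = p - 1 - r := by
    rw [hq, Nat.cast_sub (by omega), Nat.cast_sub hp.out.one_le, Nat.cast_one]
  have hx : ∀ N, ((p : ℤ_[p]) - 1) * ((x N : ℤ_[p]) - y) = q * (p : ℤ_[p]) ^ (N + 1) := by
    intro N
    simp only [x]
    push_cast
    linear_combination (q : ℤ_[p]) * hg (N + 1) - hy - hqr
  have hxt : Filter.Tendsto (fun N => (x N : ℤ_[p])) Filter.atTop (nhds y) := by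
    obtain ⟨u, hu⟩ := isUnit_prime_sub_one p
    have h : ∀ N, (x N : ℤ_[p]) = y + ↑u⁻¹ * (q * (p : ℤ_[p]) ^ (N + 1)) := by
      intro N
      rw [← hx, ← hu, Units.inv_mul_cancel_left]
      ring
    simp_rw [h]
    have h3 := ((tendsto_prime_pow p).comp (Filter.tendsto_add_atTop_nat 1)).const_mul (q : ℤ_[p])
    simpa using (h3.const_mul (↑u⁻¹ : ℤ_[p])).const_add y
  have hcard : ∀ N, ((Finset.range (x N)).filter fun j => ¬ p ∣ j).card = p ^ N * q := by
    intro N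
    have hs : g (N + 1) = p * g N + 1 := by
      simp only [g]
      rw [Finset.sum_range_succ', Finset.mul_sum, pow_zero]
      simp only [pow_succ']
    have hs' : g (N + 1) = g N + p ^ N := Finset.sum_range_succ _ _
    have hdiv : q * g (N + 1) / p = q * g N := by
      rw [hs, mul_add, mul_one, mul_left_comm, Nat.mul_add_div hp.out.pos,
        Nat.div_eq_of_lt (by have := hp.out.pos; omega), add_zero]
    rw [card_filter_not_dvd_range, hdiv, hs', mul_add, Nat.add_sub_cancel_left, mul_comm]
  have hlim : Filter.Tendsto (fun N => f (x N)) Filter.atTop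
      (nhds ((teichmullerLift p (PadicInt.toZMod c) : ℚ_[p]) ^ q * f 0)) := by
    have h : ∀ N, f (x N) = (((c ^ p ^ N : ℤ_[p]) : ℚ_[p])) ^ q * f 0 := by
      intro N
      rw [eval_natCast_of_step p h1 h2, hcard, pow_mul, PadicInt.coe_pow]
    simp_rw [h]
    refine Filter.Tendsto.mul_const _ (Filter.Tendsto.pow ?_ q)
    exact (continuous_subtype_val.tendsto _).comp (tendsto_pow_prime_pow p c)
  exact tendsto_nhds_unique ((hf.tendsto y).comp hxt) hlim

theorem teichmullerLift_neg_one_pow {k : ℕ} (hk : k < p - 1) :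
    teichmullerLift p (-1) ^ (p - 1 - k) = (-1) ^ k := by
  rcases eq_or_ne p 2 with h2 | h2
  · have hk0 : k = 0 := by omega
    have h1 : (-1 : ZMod p) = 1 := by
      subst h2; rfl
    rw [h1, map_one, one_pow, hk0, pow_zero]
  · have h1 : teichmullerLift p (-1) = -1 := by
      have hsq : teichmullerLift p (-1) ^ 2 = 1 := by rw [← map_pow]; simp
      refine (sq_eq_sq_iff_eq_or_eq_neg.mp (hsq.trans (one_pow 2).symm)).resolve_left fun h => ?_
      have h3 := toZMod_teichmullerLift p (-1)
      rw [h, map_one] at h3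
      have h4 : ((2 : ℕ) : ZMod p) = 0 := by push_cast; linear_combination h3
      rw [ZMod.natCast_eq_zero_iff] at h4
      exact h2 ((Nat.prime_dvd_prime_iff_eq hp.out Nat.prime_two).mp h4)
    rw [h1]
    have heven : Even (p - 1) := hp.out.even_sub_one h2
    have : (-1 : ℤ_[p]) ^ (p - 1 - k) * (-1) ^ k = 1 := by
      rw [← pow_add, Nat.sub_add_cancel hk.le, heven.neg_one_pow]
    have h5 : (-1 : ℤ_[p]) ^ k * (-1) ^ k = 1 := by rw [← mul_pow]; simp
    linear_combination (-1 : ℤ_[p]) ^ k * this - (-1 : ℤ_[p]) ^ (p - 1 - k) * h5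

theorem not_isUnit_neg_iff {x : ℤ_[p]} : ¬ IsUnit (-x) ↔ ¬ IsUnit x := by rw [IsUnit.neg_iff]

/-- The reflection formula for the `p`-adic Gamma function at `k / (p - 1)`. -/
theorem padicGamma_mul_padicGamma_one_sub {k : ℕ} (hk : k < p - 1) {y : ℤ_[p]}
    (hy : ((p : ℤ_[p]) - 1) * y = k) :
    padicGamma p y * padicGamma p (1 - y) = -(-1) ^ k := by
  have hc := continuous_padicGamma p
  have hf : Continuous fun x : ℤ_[p] =>
      ((padicGamma p x * padicGamma p (1 - x) : ℤ_[p]) : ℚ_[p]) := by fun_prop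
  have hstep : ∀ x : ℤ_[p], padicGamma p (1 - x) = gammaStep p (-x) * padicGamma p (-x) := by
    intro x
    rw [← padicGamma_add_one]
    congr 1; ring
  have h := eval_div_prime_sub_one_of_step p hf (c := -1) ?_ ?_ (by omega : k < p) hy
  · simp only [map_neg, map_one, sub_zero, padicGamma_zero, padicGamma_one, mul_neg, mul_one,
      PadicInt.coe_neg, PadicInt.coe_one] at h
    rw [← PadicInt.coe_pow, teichmullerLift_neg_one_pow p hk] at h
    refine PadicInt.ext ?_
    rw [h]
    simp
  · intro x hx
    rw [hstep x, padicGamma_add_one, gammaStep_of_isUnit p hx, gammaStep_of_isUnit p hx.neg]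
    have : (1 : ℤ_[p]) - (x + 1) = -x := by ring
    rw [this]
    push_cast
    ring
  · intro x hx
    rw [hstep x, padicGamma_add_one, gammaStep_of_not_isUnit p hx,
      gammaStep_of_not_isUnit p ((not_isUnit_neg_iff p).mpr hx)]
    have : (1 : ℤ_[p]) - (x + 1) = -x := by ring
    rw [this]
    push_cast
    ring

/-- The Gauss multiplication formula for the `p`-adic Gamma function at `r / (p - 1)`. -/
theorem prod_padicGamma_div_natCast {n : ℕ} {ν : ℤ_[p]} (hν : (n : ℤ_[p]) * ν = 1)
    {r : ℕ} (hr : r ≤ p - 1) {y : ℤ_[p]} (hy : ((p : ℤ_[p]) - 1) * y = r) :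
    ∏ h ∈ Finset.range n, padicGamma p (ν * (y + h)) =
      teichmullerLift p n ^ r * padicGamma p y *
        ∏ h ∈ Finset.range n, padicGamma p (ν * h) := by
  have hc := continuous_padicGamma p
  have hne : ∀ x, ((padicGamma p x : ℤ_[p]) : ℚ_[p]) ≠ 0 := by
    intro x h
    rw [PadicInt.coe_eq_zero] at h
    exact (isUnit_padicGamma p x).ne_zero h
  have huν : IsUnit ν := IsUnit.of_mul_eq_one n (by rw [mul_comm, hν])
  have hf : Continuous fun x : ℤ_[p] =>
      ((∏ h ∈ Finset.range n, padicGamma p (ν * (x + h)) : ℤ_[p]) : ℚ_[p]) /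
        (padicGamma p x : ℚ_[p]) := by
    refine Continuous.div (by fun_prop) (by fun_prop) hne
  have hstep : ∀ x : ℤ_[p], ∏ h ∈ Finset.range n, padicGamma p (ν * (x + 1 + h)) =
      gammaStep p (ν * x) * ∏ h ∈ Finset.range n, padicGamma p (ν * (x + h)) := by
    intro x
    have e1 := Finset.prod_range_succ (fun h : ℕ => padicGamma p (ν * (x + h))) n
    have e2 := Finset.prod_range_succ' (fun h : ℕ => padicGamma p (ν * (x + h))) n
    have e3 : ν * (x + n) = ν * x + 1 := by linear_combination hν
    rw [e1, e3, padicGamma_add_one] at e2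
    simp only [Nat.cast_add, Nat.cast_one, Nat.cast_zero, add_zero] at e2
    have e4 : ∀ h : ℕ, x + 1 + (h : ℤ_[p]) = x + (h + 1) := fun h => by ring
    simp only [e4]
    refine mul_right_cancel₀ (isUnit_padicGamma p (ν * x)).ne_zero ?_
    rw [← e2]; ring
  have hmain := eval_div_prime_sub_one_of_step p hf (c := ν) ?_ ?_
    (by have := hp.out.one_le; omega : r < p) hy
  · have ht : teichmullerLift p (PadicInt.toZMod ν) ^ (p - 1 - r) = teichmullerLift p n ^ r := by
      have h1 : teichmullerLift p (PadicInt.toZMod ν) * teichmullerLift p n = 1 := by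
        rw [← map_mul, ← map_natCast (PadicInt.toZMod : ℤ_[p] →+* ZMod p), ← map_mul, mul_comm, hν,
          map_one, map_one]
      have h2 : teichmullerLift p (PadicInt.toZMod ν) ^ (p - 1) = 1 := by
        rw [← map_pow, ZMod.pow_card_sub_one_eq_one, map_one]
        exact ((huν.map (PadicInt.toZMod : ℤ_[p] →+* ZMod p))).ne_zero
      calc teichmullerLift p (PadicInt.toZMod ν) ^ (p - 1 - r)
          = teichmullerLift p (PadicInt.toZMod ν) ^ (p - 1 - r) *
              (teichmullerLift p (PadicInt.toZMod ν) * teichmullerLift p n) ^ r := by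
            rw [h1, one_pow, mul_one]
        _ = teichmullerLift p (PadicInt.toZMod ν) ^ (p - 1 - r + r) * teichmullerLift p n ^ r := by
            rw [pow_add, mul_pow]; ring
        _ = _ := by rw [Nat.sub_add_cancel hr, h2, one_mul]
    rw [← PadicInt.coe_pow, ht] at hmain
    simp only [zero_add, padicGamma_zero, PadicInt.coe_one, div_one] at hmain
    rw [div_eq_iff (hne y)] at hmain
    refine PadicInt.ext ?_
    rw [hmain]
    push_cast
    ring
  · intro x hx
    simp only [hstep, padicGamma_add_one p x]
    rw [gammaStep_of_isUnit p hx, gammaStep_of_isUnit p (huν.mul hx)]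
    have hx0 : (x : ℚ_[p]) ≠ 0 := by
      intro h; rw [PadicInt.coe_eq_zero] at h; exact hx.ne_zero h
    have := hne x
    push_cast
    field_simp
  · intro x hx
    simp only [hstep, padicGamma_add_one p x]
    rw [gammaStep_of_not_isUnit p hx,
      gammaStep_of_not_isUnit p (fun h => hx (isUnit_of_mul_isUnit_right h))]
    have := hne x
    push_cast
    field_simp

end StepFunctions

section DworkSeries

open PowerSeries in
/-- The power series `exp (π (X - X ^ p))`. -/
noncomputable def dworkSeries {K : Type*} [Field K] [CharZero K] (p : ℕ) [hp : Fact p.Prime]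
    (π : K) : PowerSeries K :=
  rescale π (exp K) * expand p hp.out.ne_zero (rescale (-π) (exp K))

/-- The integers `t n` for which `π ^ n * t n / n!` is the `n`-th coefficient of
`exp (π (X - X ^ p))` when `π ^ (p - 1) = -p`. -/
def dworkNumber (p : ℕ) : ℕ → ℤ
  | 0 => 1
  | n + 1 => dworkNumber p n + n.descFactorial (p - 1) * dworkNumber p (n - (p - 1))

/-- The `n`-th coefficient of `exp (π (X - X ^ p))` when `π ^ (p - 1) = -p`. -/
noncomputable def dworkCoeff {K : Type*} [Field K] (p : ℕ) (π : K) (n : ℕ) : K :=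
  π ^ n * dworkNumber p n / n.factorial

section Field

variable {K : Type*} [Field K] [CharZero K] (p : ℕ) [hp : Fact p.Prime] {π : K}

open PowerSeries

theorem coeff_rescale_exp (a : K) (n : ℕ) :
    coeff n (rescale a (exp K)) = a ^ n / n.factorial := by
  rw [coeff_rescale, coeff_exp]
  simp [div_eq_mul_inv]

theorem derivative_rescale_exp (a : K) :
    derivative K (rescale a (exp K)) = C a * rescale a (exp K) := by
  ext n
  rw [coeff_derivative, coeff_C_mul, coeff_rescale_exp, coeff_rescale_exp, Nat.factorial_succ]
  have h1 : ((n : K) + 1) ≠ 0 := by exact_mod_cast n.succ_ne_zero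
  have h2 : ((n.factorial : ℕ) : K) ≠ 0 := by exact_mod_cast n.factorial_ne_zero
  push_cast
  field_simp
  ring

theorem derivative_expand_rescale_exp (a : K) :
    derivative K (expand p hp.out.ne_zero (rescale a (exp K))) =
      C (p * a) * X ^ (p - 1) * expand p hp.out.ne_zero (rescale a (exp K)) := by
  have hp1 := hp.out.one_le
  ext n
  rw [coeff_derivative, mul_assoc, coeff_C_mul, coeff_X_pow_mul', coeff_expand]
  by_cases h : p ∣ n + 1
  · obtain ⟨m, hm⟩ := h
    obtain ⟨m, rfl⟩ : ∃ l, m = l + 1 := Nat.exists_eq_succ_of_ne_zero (by rintro rfl; omega)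
    have hn : n = p * m + (p - 1) := by rw [mul_add, mul_one] at hm; omega
    rw [if_pos (by rw [hm]; exact dvd_mul_right _ _), if_pos (by omega), hm,
      Nat.mul_div_cancel_left _ hp.out.pos, coeff_expand, if_pos (by rw [hn]; simp),
      hn, Nat.add_sub_cancel, Nat.mul_div_cancel_left _ hp.out.pos, coeff_rescale_exp,
      coeff_rescale_exp, Nat.factorial_succ]
    have h1 : ((m : K) + 1) ≠ 0 := by exact_mod_cast m.succ_ne_zero
    have h2 : ((m.factorial : ℕ) : K) ≠ 0 := by exact_mod_cast m.factorial_ne_zero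
    have h3 : ((p * m + (p - 1) : ℕ) : K) + 1 = p * (m + 1) := by
      have : p * m + (p - 1) + 1 = p * (m + 1) := by rw [← hn, hm]
      exact_mod_cast this
    rw [h3]
    push_cast
    field_simp
    ring
  · rw [if_neg h, zero_mul]
    split_ifs with h1
    · rw [coeff_expand, if_neg, mul_zero]
      intro h2
      refine h ?_
      have := dvd_add h2 (dvd_refl p)
      rwa [show n - (p - 1) + p = n + 1 by omega] at this
    · rw [mul_zero]

theorem coeff_dworkSeries_succ (n : ℕ) :
    ((n : K) + 1) * coeff (n + 1) (dworkSeries p π) = π * coeff n (dworkSeries p π) -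
      if p - 1 ≤ n then p * π * coeff (n - (p - 1)) (dworkSeries p π) else 0 := by
  have h : derivative K (dworkSeries p π) = C π * dworkSeries p π -
      C (p * π) * (X ^ (p - 1) * dworkSeries p π) := by
    rw [dworkSeries, Derivation.leibniz, derivative_rescale_exp, derivative_expand_rescale_exp,
      mul_neg, map_neg]
    simp only [smul_eq_mul]
    ring
  have h' := congrArg (coeff n) h
  rw [coeff_derivative, map_sub, coeff_C_mul, coeff_C_mul, coeff_X_pow_mul'] at h'
  rw [mul_comm, h']
  split_ifs <;> simp

theorem coeff_dworkSeries (hπ : π ^ (p - 1) = -p) (n : ℕ) :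
    coeff n (dworkSeries p π) = dworkCoeff p π n := by
  induction n using Nat.strong_induction_on with
  | _ n ih =>
    cases n with
    | zero =>
      simp [dworkCoeff, dworkSeries, dworkNumber, coeff_mul, coeff_expand]
    | succ n =>
      have h1 : ((n : K) + 1) ≠ 0 := by exact_mod_cast n.succ_ne_zero
      have h2 : ∀ m : ℕ, ((m.factorial : ℕ) : K) ≠ 0 := fun m => by
        exact_mod_cast m.factorial_ne_zero
      have h3 := h2 n
      refine mul_left_cancel₀ h1 ?_
      rw [coeff_dworkSeries_succ, ih n (Nat.lt_succ_self n)]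
      simp only [dworkCoeff, dworkNumber, Nat.factorial_succ]
      split_ifs with h
      · rw [ih (n - (p - 1)) (by omega), dworkCoeff]
        have h4 := h2 (n - (p - 1))
        have h5 : ((n.descFactorial (p - 1) : ℕ) : K) =
            (n.factorial : K) / ((n - (p - 1)).factorial : K) := by
          rw [eq_div_iff h4, mul_comm]
          exact_mod_cast Nat.factorial_mul_descFactorial h
        have h6 : π ^ (n + 1) = -p * π * π ^ (n - (p - 1)) := by
          rw [← hπ, mul_right_comm, ← pow_add, ← pow_succ, show p - 1 + (n - (p - 1)) + 1 = n + 1 by omega]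
        push_cast
        rw [h5, h6]
        have h7 : π * π ^ n = -p * π * π ^ (n - (p - 1)) := by rw [← h6, pow_succ']
        field_simp
        linear_combination (((n - (p - 1)).factorial : ℕ) : K) * (dworkNumber p n : K) * h7
      · rw [Nat.descFactorial_of_lt (by omega)]
        push_cast
        field_simp
        ring

theorem natCast_mul_dworkCoeff (hπ : π ^ (p - 1) = -p) (n : ℕ) :
    ((n + p : ℕ) : K) * dworkCoeff p π (n + p) =
      π * dworkCoeff p π (n + p - 1) - p * π * dworkCoeff p π n := by
  have hp1 := hp.out.one_le
  have h := coeff_dworkSeries_succ p (π := π) (n + p - 1)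
  rw [if_pos (by omega), show n + p - 1 + 1 = n + p by omega,
    show n + p - 1 - (p - 1) = n by omega] at h
  simp only [coeff_dworkSeries p hπ] at h
  rw [← h]
  congr 1
  have : n + p - 1 + 1 = n + p := by omega
  exact_mod_cast this.symm

theorem dworkCoeff_eq_sum (hπ : π ^ (p - 1) = -p) {k : ℕ} (hk : k < p) (m : ℕ) :
    dworkCoeff p π (k + p * m) = ∑ i ∈ Finset.range (m + 1),
      (-π) ^ i / i.factorial * (π ^ (k + p * (m - i)) / (k + p * (m - i)).factorial) := by
  rw [← coeff_dworkSeries p hπ, dworkSeries, mul_comm (rescale π (exp K)), coeff_mul,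
    Finset.Nat.sum_antidiagonal_eq_sum_range_succ_mk]
  simp only [coeff_expand, coeff_rescale_exp, ite_mul, zero_mul]
  rw [← Finset.sum_filter]
  have him : (Finset.range (k + p * m).succ).filter (fun j => p ∣ j) =
      (Finset.range (m + 1)).image (fun i => p * i) := by
    ext j
    simp only [Finset.mem_filter, Finset.mem_range, Finset.mem_image]
    constructor
    · rintro ⟨h1, i, rfl⟩
      refine ⟨i, ?_, rfl⟩
      by_contra h2
      have : p * (m + 1) ≤ p * i := Nat.mul_le_mul_left _ (by omega)
      rw [mul_add] at this
      omega
    · rintro ⟨i, hi, rfl⟩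
      have : p * i ≤ p * m := Nat.mul_le_mul_left _ (by omega)
      exact ⟨by omega, dvd_mul_right _ _⟩
  rw [him, Finset.sum_image (fun a _ b _ h => Nat.eq_of_mul_eq_mul_left hp.out.pos h)]
  refine Finset.sum_congr rfl fun i hi => ?_
  rw [Finset.mem_range] at hi
  have : p * i ≤ p * m := Nat.mul_le_mul_left _ (by omega)
  rw [Nat.mul_div_cancel_left _ hp.out.pos, Nat.mul_sub, Nat.add_sub_assoc this]

end Field

section Divisibility

variable (p : ℕ) [hp : Fact p.Prime]

theorem prime_dvd_descFactorial {n : ℕ} (hn : ¬ p ∣ n + 1) : p ∣ n.descFactorial (p - 1) := by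
  have h1 : p ∣ (n + 1).descFactorial p :=
    (Nat.dvd_factorial hp.out.pos le_rfl).trans (Nat.factorial_dvd_descFactorial _ _)
  obtain ⟨q, hq⟩ : ∃ q, p = q + 1 := ⟨p - 1, by have := hp.out.one_le; omega⟩
  have h2 : (n + 1).descFactorial p = (n + 1) * n.descFactorial (p - 1) := by
    rw [hq, Nat.succ_descFactorial_succ, Nat.add_sub_cancel]
  rw [h2] at h1
  exact (hp.out.dvd_mul.mp h1).resolve_left hn

theorem prime_dvd_descFactorial_add_one {m : ℕ} :
    (p : ℤ) ∣ ((p * m + (p - 1)).descFactorial (p - 1) : ℤ) + 1 := by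
  rw [← ZMod.intCast_zmod_eq_zero_iff_dvd _ p]
  push_cast
  rw [Nat.descFactorial_eq_prod_range]
  have h : ((∏ i ∈ Finset.range (p - 1), (p * m + (p - 1) - i) : ℕ) : ZMod p) =
      ((∏ i ∈ Finset.range (p - 1), (p - 1 - i) : ℕ) : ZMod p) := by
    push_cast
    refine Finset.prod_congr rfl fun i hi => ?_
    rw [Finset.mem_range] at hi
    rw [Nat.add_sub_assoc hi.le]
    push_cast
    simp
  rw [h, ← Nat.descFactorial_eq_prod_range, Nat.descFactorial_self, ZMod.wilsons_lemma]
  ring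

theorem dworkNumber_modEq_of_lt {M B : ℕ} (hB : ∀ n, p * B ≤ n → (p : ℤ) ^ M ∣ dworkNumber p n)
    {m : ℕ} (hm : B + 1 ≤ m) {j : ℕ} (hj : j < p) :
    dworkNumber p (p * m + j) ≡ dworkNumber p (p * m) [ZMOD (p : ℤ) ^ (M + 1)] := by
  induction j with
  | zero => rfl
  | succ j ih =>
    refine Int.ModEq.trans ?_ (ih (by omega))
    rw [← add_assoc, dworkNumber]
    have h1 : ¬ p ∣ p * m + j + 1 := by
      rw [add_assoc, Nat.dvd_add_right (dvd_mul_right _ _)]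
      exact Nat.not_dvd_of_pos_of_lt (by omega) hj
    have h2 : p * (B + 1) ≤ p * m := Nat.mul_le_mul_left _ hm
    rw [mul_add] at h2
    refine Int.modEq_iff_dvd.mpr ?_
    rw [sub_add_cancel_left, dvd_neg, pow_succ']
    exact mul_dvd_mul (by exact_mod_cast prime_dvd_descFactorial p h1) (hB _ (by omega))

theorem pow_dvd_dworkNumber_of_block {M B : ℕ}
    (hB : ∀ n, p * B ≤ n → (p : ℤ) ^ M ∣ dworkNumber p n) {m : ℕ} (hm : B ≤ m)
    (hblock : dworkNumber p (p * m + (p - 1)) ≡ dworkNumber p (p * m) [ZMOD (p : ℤ) ^ (M + 1)]) :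
    (p : ℤ) ^ (M + 1) ∣ dworkNumber p (p * (m + 1)) := by
  have hp1 := hp.out.one_le
  have e : p * (m + 1) = p * m + (p - 1) + 1 := by rw [mul_add]; omega
  rw [e, dworkNumber, Nat.add_sub_cancel]
  have h1 : (p : ℤ) ^ (M + 1) ∣ dworkNumber p (p * m + (p - 1)) - dworkNumber p (p * m) :=
    hblock.symm.dvd
  have h2 : (p : ℤ) ^ (M + 1) ∣
      (((p * m + (p - 1)).descFactorial (p - 1) : ℤ) + 1) * dworkNumber p (p * m) := by
    rw [pow_succ']
    exact mul_dvd_mul (prime_dvd_descFactorial_add_one p) (hB _ (Nat.mul_le_mul_left _ hm))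
  refine (dvd_add h1 h2).trans (dvd_of_eq ?_)
  ring

theorem pow_dvd_dworkNumber_of_first_block {M B : ℕ}
    (hB : ∀ n, p * B ≤ n → (p : ℤ) ^ M ∣ dworkNumber p n)
    (hblock : dworkNumber p (p * B + (p - 1)) ≡ dworkNumber p (p * B) [ZMOD (p : ℤ) ^ (M + 1)])
    {n : ℕ} (hn : p * (B + 1) ≤ n) : (p : ℤ) ^ (M + 1) ∣ dworkNumber p n := by
  have h : ∀ m, B + 1 ≤ m → (p : ℤ) ^ (M + 1) ∣ dworkNumber p (p * m) := by
    intro m hm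
    obtain ⟨m, rfl⟩ : ∃ l, m = l + 1 := ⟨m - 1, by omega⟩
    refine pow_dvd_dworkNumber_of_block p hB (by omega) ?_
    rcases (Nat.succ_le_succ_iff.mp hm).eq_or_lt with rfl | h1
    · exact hblock
    · exact dworkNumber_modEq_of_lt p hB h1 (by have := hp.out.pos; omega)
  have hm : B + 1 ≤ n / p := by
    rw [Nat.le_div_iff_mul_le hp.out.pos, mul_comm]; exact hn
  have h2 := dworkNumber_modEq_of_lt p hB hm (Nat.mod_lt n hp.out.pos)
  rw [Nat.div_add_mod] at h2
  exact h2.dvd_iff.mpr (h _ hm)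

omit hp in
theorem dworkNumber_of_lt {n : ℕ} (hn : n < p) : dworkNumber p n = 1 := by
  induction n with
  | zero => rw [dworkNumber]
  | succ n ih =>
    rw [dworkNumber, Nat.descFactorial_of_lt (by omega), ih (by omega)]
    simp

theorem prime_dvd_dworkNumber {n : ℕ} (hn : p ≤ n) : (p : ℤ) ∣ dworkNumber p n := by
  have hp1 := hp.out.pos
  have := pow_dvd_dworkNumber_of_first_block p (M := 0) (B := 0) (by simp) (by
    rw [mul_zero, zero_add, dworkNumber_of_lt p (by omega), dworkNumber_of_lt p hp1])
    (n := n) (by simpa using hn)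
  simpa using this

theorem pow_dvd_dworkNumber (M : ℕ) {n : ℕ} (hn : p * (2 * M + 1) ≤ n) :
    (p : ℤ) ^ (M + 1) ∣ dworkNumber p n := by
  induction M generalizing n with
  | zero => simpa using prime_dvd_dworkNumber p (n := n) (by simpa using hn)
  | succ M ih =>
    refine pow_dvd_dworkNumber_of_first_block p (B := 2 * M + 2) (fun n hn => ih ?_) ?_ hn
    · refine le_trans (Nat.mul_le_mul_left _ (by omega)) hn
    · exact dworkNumber_modEq_of_lt p (B := 2 * M + 1) (fun n hn => ih hn) le_rfl
        (by have := hp.out.pos; omega)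

end Divisibility

end DworkSeries

section DworkBounds

variable (p : ℕ) [hp : Fact p.Prime]

theorem PadicComplex.norm_natCast_eq (n : ℕ) : ‖(n : ℂ_[p])‖ = ‖(n : ℚ_[p])‖ := by
  rw [← map_natCast (algebraMap ℚ_[p] ℂ_[p]), norm_algebraMap']

theorem PadicComplex.norm_intCast_eq (n : ℤ) : ‖(n : ℂ_[p])‖ = ‖(n : ℚ_[p])‖ := by
  rw [← map_intCast (algebraMap ℚ_[p] ℂ_[p]), norm_algebraMap']

theorem PadicComplex.norm_prime : ‖(p : ℂ_[p])‖ = (p : ℝ)⁻¹ := by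
  rw [PadicComplex.norm_natCast_eq, Padic.norm_p]

theorem PadicComplex.norm_factorial (n : ℕ) :
    ‖(n.factorial : ℂ_[p])‖ = (p : ℝ)⁻¹ ^ padicValNat p n.factorial := by
  rw [PadicComplex.norm_natCast_eq, Padic.norm_eq_zpow_neg_valuation
    (by exact_mod_cast n.factorial_ne_zero), Padic.valuation_natCast, zpow_neg, zpow_natCast,
    inv_pow]

theorem PadicComplex.norm_le_of_pow_dvd {n : ℤ} {M : ℕ} (h : (p : ℤ) ^ M ∣ n) :
    ‖(n : ℂ_[p])‖ ≤ (p : ℝ)⁻¹ ^ M := by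
  rw [PadicComplex.norm_intCast_eq, inv_pow, ← zpow_natCast, ← zpow_neg]
  exact (Padic.norm_int_le_pow_iff_dvd n M).mpr h

theorem PadicComplex.norm_intCast_le_one (n : ℤ) : ‖(n : ℂ_[p])‖ ≤ 1 := by
  rw [PadicComplex.norm_intCast_eq]; exact Padic.norm_int_le_one n

theorem inv_prime_pos : 0 < (p : ℝ)⁻¹ := inv_pos.mpr (by exact_mod_cast hp.out.pos)

theorem inv_prime_lt_one : (p : ℝ)⁻¹ < 1 :=
  inv_lt_one_of_one_lt₀ (by exact_mod_cast hp.out.one_lt)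

variable {π : ℂ_[p]} (hπ : π ^ (p - 1) = -p)

include hπ in
theorem norm_pow_prime_sub_one : ‖π‖ ^ (p - 1) = (p : ℝ)⁻¹ := by
  rw [← norm_pow, hπ, norm_neg, PadicComplex.norm_prime]

include hπ in
theorem ne_zero_of_pow_prime_sub_one : π ≠ 0 := by
  intro h
  have h1 := norm_pow_prime_sub_one p hπ
  have h2 : p - 1 ≠ 0 := by have := hp.out.two_le; omega
  rw [h, norm_zero, zero_pow h2] at h1
  exact (inv_prime_pos p).ne h1

include hπ in
theorem norm_pow_div_factorial_pow (n : ℕ) :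
    ‖π ^ n / n.factorial‖ ^ (p - 1) = (p : ℝ)⁻¹ ^ (p.digits n).sum := by
  rw [norm_div, norm_pow, PadicComplex.norm_factorial, div_pow, ← pow_mul, ← pow_mul, mul_comm n,
    pow_mul, norm_pow_prime_sub_one p hπ, mul_comm _ (p - 1), sub_one_mul_padicValNat_factorial,
    div_eq_iff (pow_pos (inv_prime_pos p) _).ne', ← pow_add,
    Nat.add_sub_cancel' (Nat.digit_sum_le p n)]

include hπ in
theorem norm_pow_div_factorial_le_one (n : ℕ) : ‖π ^ n / n.factorial‖ ≤ 1 := by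
  have h := norm_pow_div_factorial_pow p hπ n
  have h2 : p - 1 ≠ 0 := by have := hp.out.two_le; omega
  rw [← pow_le_one_iff_of_nonneg (norm_nonneg _) h2, h]
  exact pow_le_one₀ (inv_prime_pos p).le (inv_prime_lt_one p).le

include hπ in
theorem norm_factorial_div_pow_le (n : ℕ) :
    ‖(n.factorial : ℂ_[p])‖ / ‖π‖ ^ n ≤ p * (n + 1) := by
  have hp0 : (0 : ℝ) < p := by exact_mod_cast hp.out.pos
  have h := norm_pow_div_factorial_pow p hπ n
  have h2 : p - 1 ≠ 0 := by have := hp.out.two_le; omega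
  have hπ0 : 0 < ‖π‖ := norm_pos_iff.mpr (ne_zero_of_pow_prime_sub_one p hπ)
  have hlen : (p : ℝ) ^ (p.digits n).length ≤ p * (n + 1) := by
    rcases eq_or_ne n 0 with rfl | hn
    · simpa using (by exact_mod_cast hp.out.one_le : (1 : ℝ) ≤ p)
    · have h3 := Nat.base_pow_length_digits_le p n hp.out.one_lt hn
      have h4 : (p : ℝ) ^ (p.digits n).length ≤ p * n := by exact_mod_cast h3
      nlinarith
  refine le_trans ?_ hlen
  have hsum : (p.digits n).sum ≤ (p.digits n).length * (p - 1) := by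
    have := List.sum_le_card_nsmul (p.digits n) (p - 1) (fun d hd => by
      have := Nat.digits_lt_base hp.out.one_lt hd; omega)
    simpa using this
  refine le_of_pow_le_pow_left₀ h2 (by positivity) ?_
  have h5 : ‖(n.factorial : ℂ_[p])‖ / ‖π‖ ^ n = ‖π ^ n / n.factorial‖⁻¹ := by
    rw [norm_div, norm_pow, inv_div]
  rw [h5, inv_pow, h, inv_pow, inv_inv, ← pow_mul]
  exact pow_le_pow_right₀ (by exact_mod_cast hp.out.one_le) hsum

include hπ in
theorem norm_dworkCoeff_le_of_pow_dvd {n M : ℕ} (h : (p : ℤ) ^ M ∣ dworkNumber p n) :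
    ‖dworkCoeff p π n‖ ≤ (p : ℝ)⁻¹ ^ M := by
  rw [dworkCoeff, mul_div_right_comm, norm_mul]
  exact (mul_le_of_le_one_left (norm_nonneg _) (norm_pow_div_factorial_le_one p hπ n)).trans
    (PadicComplex.norm_le_of_pow_dvd p h)

include hπ in
theorem exists_norm_dworkCoeff_le :
    ∃ ρ : ℝ, 0 < ρ ∧ ρ < 1 ∧ ∀ n, ‖dworkCoeff p π n‖ ≤ p * ρ ^ n := by
  have hp0 : (0 : ℝ) < p := by exact_mod_cast hp.out.pos
  have h2p : 2 * p ≠ 0 := by have := hp.out.pos; omega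
  set ρ : ℝ := (p : ℝ)⁻¹ ^ ((2 * p : ℕ) : ℝ)⁻¹ with hρ
  have hρp : ρ ^ (2 * p) = (p : ℝ)⁻¹ := Real.rpow_inv_natCast_pow (inv_prime_pos p).le h2p
  have hρ0 : 0 < ρ := Real.rpow_pos_of_pos (inv_prime_pos p) _
  have hρ1 : ρ < 1 := Real.rpow_lt_one (inv_prime_pos p).le (inv_prime_lt_one p)
    (inv_pos.mpr (by exact_mod_cast Nat.pos_of_ne_zero h2p))
  refine ⟨ρ, hρ0, hρ1, fun n => ?_⟩
  set M := n / (2 * p) with hM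
  have hdiv : (p : ℤ) ^ M ∣ dworkNumber p n := by
    rcases Nat.eq_zero_or_pos M with h0 | h0
    · simp [h0]
    · obtain ⟨L, hL⟩ : ∃ L, M = L + 1 := ⟨M - 1, by omega⟩
      rw [hL]
      refine pow_dvd_dworkNumber p L ?_
      have h1 : (2 * p) * M ≤ n := Nat.mul_div_le n (2 * p)
      rw [hL] at h1
      nlinarith [hp.out.pos]
  refine (norm_dworkCoeff_le_of_pow_dvd p hπ hdiv).trans ?_
  have hmod := Nat.div_add_mod n (2 * p)
  rw [← hM] at hmod
  have hlt := Nat.mod_lt n (Nat.pos_of_ne_zero h2p)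
  rw [← hρp, ← pow_mul]
  have h3 : ρ ^ (2 * p * M) * ρ ^ (2 * p) ≤ ρ ^ n := by
    rw [← pow_add]
    exact pow_le_pow_of_le_one hρ0.le hρ1.le (by linarith)
  rw [hρp] at h3
  calc ρ ^ (2 * p * M) = p * (ρ ^ (2 * p * M) * (p : ℝ)⁻¹) := by field_simp
    _ ≤ p * ρ ^ n := mul_le_mul_of_nonneg_left h3 hp0.le

include hπ in
theorem summable_norm_dworkCoeff : Summable fun n => ‖dworkCoeff p π n‖ := by
  obtain ⟨ρ, h0, h1, h⟩ := exists_norm_dworkCoeff_le p hπ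
  exact Summable.of_nonneg_of_le (fun _ => norm_nonneg _) h
    ((summable_geometric_of_lt_one h0.le h1).mul_left _)

end DworkBounds

section TraceFormula

variable (p : ℕ) [hp : Fact p.Prime] {π : ℂ_[p]} (hπ : π ^ (p - 1) = -p)

/-- The product `(-π) ^ (-r) * y * (y - 1) * ⋯ * (y - r + 1)`. -/
noncomputable def fallingWeight {K : Type*} [Field K] (π y : K) (r : ℕ) : K :=
  ∏ l ∈ Finset.range r, (y - l) / -π

theorem fallingWeight_succ {K : Type*} [Field K] (π y : K) (r : ℕ) :
    fallingWeight π y (r + 1) = fallingWeight π y r * ((y - r) / -π) :=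
  Finset.prod_range_succ _ _

theorem fallingWeight_succ' {K : Type*} [Field K] (π y : K) (r : ℕ) :
    fallingWeight π (y + 1) (r + 1) = fallingWeight π y r * ((y + 1) / -π) := by
  rw [fallingWeight, Finset.prod_range_succ', fallingWeight]
  simp

/-- The diagonal sums of the matrix of the Frobenius operator times a primitive. -/
noncomputable def dworkDiagonal (π : ℂ_[p]) (k : ℕ) (s : ℂ_[p]) (m : ℕ) : ℂ_[p] :=
  ∑ r ∈ Finset.range (m + 1), dworkCoeff p π (k + (p - 1) * m + r) * fallingWeight π (s + m) r

include hπ in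
theorem dworkDiagonal_succ {k : ℕ} {s : ℂ_[p]} (hs : ((p : ℂ_[p]) - 1) * s = k) (m : ℕ) :
    (p : ℂ_[p]) * dworkDiagonal p π k s m = p * dworkDiagonal p π k s (m + 1) +
      (1 - p) * dworkCoeff p π (k + (p - 1) * (m + 1)) -
      fallingWeight π (s + m) (m + 1) * dworkCoeff p π (k + p * (m + 1)) := by
  have hπ0 := ne_zero_of_pow_prime_sub_one p hπ
  have hp1 := hp.out.one_le
  have hp2 := hp.out.two_le
  set y : ℂ_[p] := s + m with hy
  have hpc : ((p - 1 : ℕ) : ℂ_[p]) = (p : ℂ_[p]) - 1 := by rw [Nat.cast_sub hp1, Nat.cast_one]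
  have hy0 : y + 1 ≠ 0 := by
    intro h
    have h1 : ((k + (p - 1) * (m + 1) : ℕ) : ℂ_[p]) = 0 := by
      push_cast
      rw [hpc, ← hs]
      linear_combination ((p : ℂ_[p]) - 1) * h
    rw [Nat.cast_eq_zero] at h1
    have : 0 < (p - 1) * (m + 1) := Nat.mul_pos (by omega) (by omega)
    omega
  set N := k + (p - 1) * (m + 1) with hN
  let w : ℕ → ℂ_[p] := fallingWeight π (y + 1)
  let c : ℕ → ℂ_[p] := dworkCoeff p π
  have hw : ∀ r, w (r + 1) * (y + 1 - (r + 1)) = -π * w (r + 2) := by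
    intro r
    simp only [w]
    rw [fallingWeight_succ π (y + 1) (r + 1)]
    push_cast
    field_simp
  have hw' : ∀ r, fallingWeight π y r * (y + 1) = -π * w (r + 1) := by
    intro r
    simp only [w]
    rw [fallingWeight_succ']
    field_simp
  have hrec : ∀ r, (p * (y + 1) - (y + 1 - (r + 1))) * c (N + r + 1) =
      π * c (N + r) - p * π * c (k + (p - 1) * m + r) := by
    intro r
    have h := natCast_mul_dworkCoeff p hπ (k + (p - 1) * m + r)
    have e : k + (p - 1) * m + r + p = N + r + 1 := by
      rw [hN, mul_add]; omega
    rw [e, Nat.add_sub_cancel] at h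
    rw [← h]
    congr 1
    rw [hN]
    push_cast
    rw [hpc, ← hs, hy]
    ring
  have hterm : ∀ r, p * (y + 1) * (c (k + (p - 1) * m + r) * fallingWeight π y r) =
      p * (y + 1) * (c (N + (r + 1)) * w (r + 1)) +
        π * (w (r + 2) * c (N + (r + 1)) - w (r + 1) * c (N + r)) := by
    intro r
    have h1 := hw r
    have h2 := hw' r
    have h3 := hrec r
    rw [add_assoc N r 1] at h3
    linear_combination (p * c (k + (p - 1) * m + r)) * h2 - w (r + 1) * h3 -
      c (N + (r + 1)) * h1
  have hsum : p * (y + 1) * dworkDiagonal p π k s m =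
      p * (y + 1) * (∑ r ∈ Finset.range (m + 1), c (N + (r + 1)) * w (r + 1)) +
        π * (w (m + 2) * c (N + (m + 1)) - w 1 * c N) := by
    rw [dworkDiagonal, Finset.mul_sum, Finset.mul_sum]
    simp only [← hy]
    rw [Finset.sum_congr rfl fun r _ => hterm r, Finset.sum_add_distrib, ← Finset.mul_sum,
      ← Finset.mul_sum, Finset.sum_range_sub (fun r => w (r + 1) * c (N + r))]
    rfl
  have hdiag : dworkDiagonal p π k s (m + 1) =
      (∑ r ∈ Finset.range (m + 1), c (N + (r + 1)) * w (r + 1)) + c N := by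
    rw [dworkDiagonal, Finset.sum_range_succ']
    have : s + ((m + 1 : ℕ) : ℂ_[p]) = y + 1 := by rw [hy]; push_cast; ring
    rw [this]
    simp [w, c, hN, fallingWeight]
  have h1 : π * w 1 = -(y + 1) := by
    simp only [w, fallingWeight, Finset.prod_range_one, Nat.cast_zero, sub_zero]
    field_simp
  have h2 : π * w (m + 2) = -(y + 1) * fallingWeight π y (m + 1) := by
    linear_combination hw' (m + 1)
  have e2 : N + (m + 1) = k + p * (m + 1) := by
    obtain ⟨q, hq⟩ : ∃ q, p = q + 1 := ⟨p - 1, by omega⟩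
    rw [hN, hq, Nat.add_sub_cancel]; ring
  rw [hdiag]
  refine mul_left_cancel₀ hy0 ?_
  rw [← e2]
  linear_combination hsum + c (N + (m + 1)) * h2 - c N * h1

include hπ in
theorem sum_dworkCoeff_eq {k : ℕ} {s : ℂ_[p]} (hs : ((p : ℂ_[p]) - 1) * s = k) (m : ℕ) :
    (1 - p : ℂ_[p]) * ∑ i ∈ Finset.range (m + 1), dworkCoeff p π (k + (p - 1) * i) =
      ∑ i ∈ Finset.range (m + 1),
        fallingWeight π (s + i - 1) i * dworkCoeff p π (k + p * i) -
      p * dworkDiagonal p π k s m := by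
  induction m with
  | zero => simp [dworkDiagonal, fallingWeight]; ring
  | succ m ih =>
    rw [Finset.sum_range_succ, mul_add, ih, Finset.sum_range_succ _ (m + 1),
      dworkDiagonal_succ p hπ hs m]
    have : s + ((m + 1 : ℕ) : ℂ_[p]) - 1 = s + m := by push_cast; ring
    rw [this]
    ring

theorem norm_prod_sub_natCast_le (y : ℤ_[p]) (r : ℕ) :
    ‖∏ l ∈ Finset.range r, (y - l)‖ ≤ ‖(r.factorial : ℤ_[p])‖ := by
  rw [← descPochhammer_eval_eq_prod_range]
  have h := PadicInt.norm_ascPochhammer_le r (-y)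
  rw [ascPochhammer_eval_neg_eq_descPochhammer, norm_mul, norm_pow, norm_neg, norm_one, one_pow,
    one_mul] at h
  exact h

include hπ in
theorem norm_fallingWeight_le (y : ℤ_[p]) (r : ℕ) :
    ‖fallingWeight π (algebraMap ℚ_[p] ℂ_[p] y) r‖ ≤ p * (r + 1) := by
  refine le_trans (le_of_eq ?_) ((div_le_div_of_nonneg_right (norm_prod_sub_natCast_le p y r)
    (pow_nonneg (norm_nonneg π) r)).trans (le_trans (le_of_eq ?_)
      (norm_factorial_div_pow_le p hπ r)))
  · rw [fallingWeight, Finset.prod_div_distrib, norm_div, Finset.prod_const, Finset.card_range,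
      norm_pow, norm_neg]
    congr 1
    have : (∏ l ∈ Finset.range r, (algebraMap ℚ_[p] ℂ_[p] y - l)) =
        algebraMap ℚ_[p] ℂ_[p] ((∏ l ∈ Finset.range r, (y - l) : ℤ_[p]) : ℚ_[p]) := by
      have h : ((∏ l ∈ Finset.range r, (y - l) : ℤ_[p]) : ℚ_[p]) =
          ∏ l ∈ Finset.range r, ((y : ℚ_[p]) - l) := by
        refine (map_prod (PadicInt.Coe.ringHom (p := p)) _ _).trans ?_
        refine Finset.prod_congr rfl fun l _ => ?_
        exact (PadicInt.coe_sub _ _).trans (by rw [PadicInt.coe_natCast])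
      rw [h, map_prod]
      simp
    rw [this, norm_algebraMap', ← PadicInt.norm_def]
  · rw [PadicComplex.norm_natCast_eq, PadicInt.norm_def, PadicInt.coe_natCast]

include hπ in
theorem tendsto_dworkDiagonal (k : ℕ) (s : ℤ_[p]) :
    Filter.Tendsto (dworkDiagonal p π k (algebraMap ℚ_[p] ℂ_[p] s)) Filter.atTop (nhds 0) := by
  obtain ⟨ρ, h0, h1, h⟩ := exists_norm_dworkCoeff_le p hπ
  have hp0 : (0 : ℝ) < p := by exact_mod_cast hp.out.pos
  have hp2 := hp.out.two_le
  have hbound : ∀ m, ‖dworkDiagonal p π k (algebraMap ℚ_[p] ℂ_[p] s) m‖ ≤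
      (p : ℝ) * p * ((m : ℝ) ^ 1 * ρ ^ m + ρ ^ m) := by
    intro m
    refine IsUltrametricDist.norm_sum_le_of_forall_le_of_nonneg (by positivity) fun r hr => ?_
    rw [Finset.mem_range] at hr
    have e : algebraMap ℚ_[p] ℂ_[p] s + m = algebraMap ℚ_[p] ℂ_[p] ((s + m : ℤ_[p]) : ℚ_[p]) := by
      push_cast
      simp
    rw [e, norm_mul]
    have h2 := norm_fallingWeight_le p hπ (s + m) r
    have h3 : ρ ^ (k + (p - 1) * m + r) ≤ ρ ^ m := by
      refine pow_le_pow_of_le_one h0.le h1.le ?_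
      have : 1 * m ≤ (p - 1) * m := Nat.mul_le_mul_right _ (by omega)
      omega
    have h4 : (r : ℝ) + 1 ≤ m + 1 := by
      have : r ≤ m := by omega
      have : (r : ℝ) ≤ m := by exact_mod_cast this
      linarith
    calc _ ≤ (p * ρ ^ m) * (p * (m + 1)) := by
          refine mul_le_mul ((h _).trans (mul_le_mul_of_nonneg_left h3 hp0.le))
            (h2.trans (mul_le_mul_of_nonneg_left h4 hp0.le)) (norm_nonneg _) (by positivity)
      _ = _ := by ring
  refine squeeze_zero_norm hbound ?_
  have h5 := tendsto_pow_const_mul_const_pow_of_abs_lt_one 1 (r := ρ) (by rwa [abs_of_pos h0])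
  have h6 := tendsto_pow_atTop_nhds_zero_of_lt_one h0.le h1
  simpa using (h5.add h6).const_mul ((p : ℝ) * p)

end TraceFormula

section GammaExpansion

variable (p : ℕ) [hp : Fact p.Prime] {π : ℂ_[p]} (hπ : π ^ (p - 1) = -p)

theorem natCast_factorial_mul_padicGamma_neg {k : ℕ} (hk : k < p) (j : ℕ) :
    ((k + p * j).factorial : ℤ_[p]) * padicGamma p (-((k + p * j : ℕ) : ℤ_[p])) =
      (-p) ^ j * j.factorial := by
  have hstep : ∀ N : ℕ, padicGamma p (-(N : ℤ_[p])) =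
      gammaStep p (-((N + 1 : ℕ) : ℤ_[p])) * padicGamma p (-((N + 1 : ℕ) : ℤ_[p])) := by
    intro N
    rw [← padicGamma_add_one]
    congr 1
    push_cast
    ring
  have hnd : ∀ j k : ℕ, k < p →
      ((k + p * j).factorial : ℤ_[p]) * padicGamma p (-((k + p * j : ℕ) : ℤ_[p])) =
      ((p * j).factorial : ℤ_[p]) * padicGamma p (-((p * j : ℕ) : ℤ_[p])) := by
    intro j k hk
    induction k with
    | zero => rw [zero_add]
    | succ k ih =>
      rw [← ih (by omega), hstep (k + p * j), show k + 1 + p * j = k + p * j + 1 by ring,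
        gammaStep_of_isUnit, Nat.factorial_succ]
      · push_cast
        ring
      · rw [IsUnit.neg_iff, PadicInt.isUnit_natCast_iff, show k + p * j + 1 = p * j + (k + 1) by ring,
          Nat.dvd_add_right (dvd_mul_right _ _)]
        exact Nat.not_dvd_of_pos_of_lt (by omega) hk
  rw [hnd j k hk]
  induction j with
  | zero => simp [padicGamma_zero]
  | succ j ih =>
    have hp1 := hp.out.one_le
    have e : p * (j + 1) = (p - 1) + p * j + 1 := by rw [mul_add]; omega
    have h1 := hnd j (p - 1) (by omega)
    rw [ih, hstep ((p - 1) + p * j), ← e, gammaStep_of_not_isUnit] at h1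
    · have e' : ((p * (j + 1)).factorial : ℤ_[p]) =
          (p * (j + 1) : ℤ_[p]) * ((p - 1 + p * j).factorial : ℤ_[p]) := by
        rw [e, Nat.factorial_succ, ← e]
        push_cast
        ring
      rw [e', Nat.factorial_succ]
      push_cast at h1 ⊢
      linear_combination (-(p * (j + 1) : ℤ_[p])) * h1
    · rw [IsUnit.neg_iff, PadicInt.isUnit_natCast_iff]
      simp

/-- The continuous function `x ↦ Γ_p(-k - p x)`. -/
noncomputable def shiftedGamma (k : ℕ) : C(ℤ_[p], ℤ_[p]) where
  toFun x := padicGamma p (-k - p * x)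
  continuous_toFun := by
    have := continuous_padicGamma p
    fun_prop

theorem shiftedGamma_apply (k : ℕ) (x : ℤ_[p]) :
    shiftedGamma p k x = padicGamma p (-k - p * x) := rfl

include hπ in
theorem dworkCoeff_eq_fwdDiff {k : ℕ} (hk : k < p) (m : ℕ) :
    dworkCoeff p π (k + p * m) = π ^ (k + m) / m.factorial *
      algebraMap ℚ_[p] ℂ_[p] ((fwdDiff 1)^[m] (shiftedGamma p k) 0 : ℤ_[p]) := by
  let φ : ℤ_[p] →+* ℂ_[p] := (algebraMap ℚ_[p] ℂ_[p]).comp PadicInt.Coe.ringHom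
  change _ = _ * φ _
  have hp1 := hp.out.one_le
  rw [dworkCoeff_eq_sum p hπ hk, fwdDiff_iter_eq_sum_shift, map_sum, Finset.mul_sum,
    ← Finset.sum_range_reflect]
  refine Finset.sum_congr rfl fun j hj => ?_
  rw [Finset.mem_range] at hj
  have hj' : j ≤ m := by omega
  rw [show m + 1 - 1 - j = m - j by omega, show m - (m - j) = j by omega]
  have hfac : ∀ a : ℕ, ((a.factorial : ℕ) : ℂ_[p]) ≠ 0 := fun a => by
    exact_mod_cast a.factorial_ne_zero
  have h1 := congrArg φ (natCast_factorial_mul_padicGamma_neg p hk j)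
  have hval : shiftedGamma p k (0 + j • 1) = padicGamma p (-((k + p * j : ℕ) : ℤ_[p])) := by
    rw [shiftedGamma_apply]
    congr 1
    simp
    ring
  rw [hval]
  set G := padicGamma p (-((k + p * j : ℕ) : ℤ_[p])) with hG
  have h2 : π ^ (p * j) = π ^ j * (-p) ^ j := by
    rw [pow_mul, ← mul_pow, ← hπ, ← pow_succ', Nat.sub_add_cancel hp1]
  simp only [map_mul, map_pow, map_neg, map_natCast] at h1
  have h3 : (-p : ℂ_[p]) ^ j / ((k + p * j).factorial : ℂ_[p]) = φ G / j.factorial := by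
    rw [div_eq_div_iff (hfac _) (hfac _), ← h1]
    ring
  have h4 : (m.choose j : ℂ_[p]) = m.factorial / (j.factorial * (m - j).factorial) :=
    Nat.cast_choose _ hj'
  have h5 : π ^ (k + m) = π ^ k * π ^ j * π ^ (m - j) := by
    rw [← pow_add, ← pow_add]; congr 1; omega
  simp only [zsmul_eq_mul, map_mul, map_intCast]
  push_cast
  rw [h4, h5, pow_add, h2, neg_pow π (m - j)]
  have e1 := hfac m
  have e2 := hfac j
  have e3 := hfac (m - j)
  calc _ = (-1) ^ (m - j) * π ^ (m - j) / ((m - j).factorial : ℂ_[p]) * (π ^ k * π ^ j) *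
        ((-p : ℂ_[p]) ^ j / ((k + p * j).factorial : ℂ_[p])) := by ring
    _ = _ := by
      rw [h3]
      field_simp

theorem fallingWeight_sub_one {K : Type*} [Field K] (π s : K) (m : ℕ) :
    fallingWeight π (s + m - 1) m = ∏ l ∈ Finset.range m, (s + l) / -π := by
  rw [fallingWeight, ← Finset.prod_range_reflect]
  refine Finset.prod_congr rfl fun l hl => ?_
  rw [Finset.mem_range] at hl
  rw [Nat.sub_sub, Nat.cast_sub (by omega)]
  push_cast
  ring

theorem factorial_mul_choose (x : ℤ_[p]) (m : ℕ) :
    (m.factorial : ℤ_[p]) * Ring.choose x m = ∏ l ∈ Finset.range m, (x - l) := by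
  rw [← nsmul_eq_mul, ← Ring.descPochhammer_eq_factorial_smul_choose, ← Polynomial.aeval_eq_smeval,
    Polynomial.aeval_def, Polynomial.eval₂_eq_eval_map, descPochhammer_map,
    descPochhammer_eval_eq_prod_range]

include hπ in
theorem hasSum_padicGamma_div {k : ℕ} (hk : k < p) {s : ℤ_[p]}
    (hs : ((p : ℤ_[p]) - 1) * s = k) :
    HasSum (fun m : ℕ => fallingWeight π (algebraMap ℚ_[p] ℂ_[p] s + m - 1) m *
        dworkCoeff p π (k + p * m))
      (π ^ k * algebraMap ℚ_[p] ℂ_[p] (padicGamma p s)) := by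
  let φ : ℤ_[p] →+* ℂ_[p] := (algebraMap ℚ_[p] ℂ_[p]).comp PadicInt.Coe.ringHom
  have hφ : Continuous φ :=
    (continuous_algebraMap ℚ_[p] ℂ_[p]).comp continuous_subtype_val
  have hπ0 := ne_zero_of_pow_prime_sub_one p hπ
  have h1 := ContinuousMap.hasSum_apply (PadicInt.hasSum_mahler (shiftedGamma p k)) (-s)
  have e : shiftedGamma p k (-s) = padicGamma p s := by
    rw [shiftedGamma_apply]
    congr 1
    linear_combination hs
  rw [e] at h1
  have h2 := (h1.map φ hφ).mul_left (π ^ k)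
  refine HasSum.congr_fun h2 fun m => ?_
  have hfac : ((m.factorial : ℕ) : ℂ_[p]) ≠ 0 := by exact_mod_cast m.factorial_ne_zero
  have h3 := congrArg φ (factorial_mul_choose p (-s) m)
  rw [map_mul, map_natCast, map_prod] at h3
  have h4 : ∏ l ∈ Finset.range m, φ (-s - l) =
      (-1) ^ m * ∏ l ∈ Finset.range m, (φ s + l) := by
    rw [← Finset.card_range m, ← Finset.prod_const, Finset.card_range, ← Finset.prod_mul_distrib]
    refine Finset.prod_congr rfl fun l _ => ?_
    rw [map_sub, map_neg, map_natCast]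
    ring
  rw [h4] at h3
  have h5 : φ (Ring.choose (-s) m) =
      (-1) ^ m * (∏ l ∈ Finset.range m, (φ s + l)) / m.factorial := by
    rw [eq_div_iff hfac, ← h3, mul_comm]
  have h6 : (-1 : ℂ_[p]) ^ m * (-1) ^ m = 1 := by rw [← mul_pow]; simp
  simp only [Function.comp_apply]
  rw [PadicInt.mahlerTerm_apply, mahler_apply, smul_eq_mul, map_mul, h5,
    dworkCoeff_eq_fwdDiff p hπ hk, fallingWeight_sub_one, Finset.prod_div_distrib,
    Finset.prod_const, Finset.card_range, neg_pow, pow_add]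
  change (∏ l ∈ Finset.range m, (φ s + l)) / _ * (_ * φ _) = _
  have h7 : ((-1 : ℂ_[p]) ^ m)⁻¹ = (-1) ^ m := inv_eq_of_mul_eq_one_left h6
  rw [div_eq_mul_inv, mul_inv, h7]
  field_simp

include hπ in
theorem summable_norm_dworkCoeff_progression (k : ℕ) :
    Summable fun m : ℕ => ‖dworkCoeff p π (k + (p - 1) * m)‖ := by
  have hp2 := hp.out.two_le
  refine (summable_norm_dworkCoeff p hπ).comp_injective (i := fun m => k + (p - 1) * m) ?_
  intro a b h
  exact Nat.eq_of_mul_eq_mul_left (by omega : 0 < p - 1) (Nat.add_left_cancel h)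

include hπ in
theorem one_sub_prime_mul_tsum_dworkCoeff {k : ℕ} (hk : k < p) {s : ℤ_[p]}
    (hs : ((p : ℤ_[p]) - 1) * s = k) :
    (1 - p : ℂ_[p]) * ∑' m : ℕ, dworkCoeff p π (k + (p - 1) * m) =
      π ^ k * algebraMap ℚ_[p] ℂ_[p] (padicGamma p s) := by
  have hs' : ((p : ℂ_[p]) - 1) * algebraMap ℚ_[p] ℂ_[p] s = k := by
    have := congrArg (fun x : ℤ_[p] => algebraMap ℚ_[p] ℂ_[p] (x : ℚ_[p])) hs
    simpa using this
  have h1 := ((summable_norm_dworkCoeff_progression p hπ k).of_norm.hasSum.tendsto_sum_nat.comp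
    (Filter.tendsto_add_atTop_nat 1)).const_mul (1 - p : ℂ_[p])
  have h2 := ((hasSum_padicGamma_div p hπ hk hs).tendsto_sum_nat.comp
    (Filter.tendsto_add_atTop_nat 1)).sub ((tendsto_dworkDiagonal p hπ k s).const_mul (p : ℂ_[p]))
  rw [mul_zero, sub_zero] at h2
  refine tendsto_nhds_unique h1 (h2.congr fun m => ?_)
  exact (sum_dworkCoeff_eq p hπ hs' m).symm

end GammaExpansion

section PowerSeriesEvaluation

variable {K : Type*} [NormedField K] [CompleteSpace K]

open PowerSeries

omit [CompleteSpace K] in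
theorem summable_norm_coeff_mul {f g : PowerSeries K} (hf : Summable fun n => ‖coeff n f‖)
    (hg : Summable fun n => ‖coeff n g‖) : Summable fun n => ‖coeff n (f * g)‖ := by
  simp only [coeff_mul]
  exact summable_norm_sum_mul_antidiagonal_of_summable_norm
    (f := fun n => coeff n f) (g := fun n => coeff n g) hf hg

theorem tsum_coeff_mul {f g : PowerSeries K} (hf : Summable fun n => ‖coeff n f‖)
    (hg : Summable fun n => ‖coeff n g‖) :
    ∑' n, coeff n (f * g) = (∑' n, coeff n f) * ∑' n, coeff n g := by
  simp only [coeff_mul]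
  exact (tsum_mul_tsum_eq_tsum_sum_antidiagonal_of_summable_norm
    (f := fun n => coeff n f) (g := fun n => coeff n g) hf hg).symm

theorem summable_norm_coeff_pow_and_tsum_coeff_pow {f : PowerSeries K}
    (hf : Summable fun n => ‖coeff n f‖) (m : ℕ) :
    (Summable fun n => ‖coeff n (f ^ m)‖) ∧ ∑' n, coeff n (f ^ m) = (∑' n, coeff n f) ^ m := by
  induction m with
  | zero =>
    simp only [pow_zero, coeff_one]
    refine ⟨summable_of_ne_finset_zero (s := {0}) fun n hn => ?_, tsum_ite_eq 0 _⟩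
    rw [Finset.mem_singleton] at hn
    simp [hn]
  | succ m ih =>
    rw [pow_succ, pow_succ, ← ih.2, tsum_coeff_mul ih.1 hf]
    exact ⟨summable_norm_coeff_mul ih.1 hf, rfl⟩

end PowerSeriesEvaluation

section DworkSplitting

variable (p : ℕ) [hp : Fact p.Prime] {π : ℂ_[p]} (hπ : π ^ (p - 1) = -p)

/-- The value at `1` of Dwork's power series `exp (π (X - X ^ p))`. -/
noncomputable def dworkValue (π : ℂ_[p]) : ℂ_[p] := ∑' n, dworkCoeff p π n

open PowerSeries in
include hπ in
theorem dworkValue_pow_prime : dworkValue p π ^ p = 1 := by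
  have hp0 : (p : ℝ)⁻¹ < 1 := inv_prime_lt_one p
  have hsum : ∀ a : ℂ_[p], ‖a‖ = ‖π‖ → 
      Summable fun n => ‖coeff n (rescale (p * a : ℂ_[p]) (exp ℂ_[p]))‖ := by
    intro a ha
    refine Summable.of_nonneg_of_le (fun _ => norm_nonneg _) (fun n => ?_)
      (summable_geometric_of_lt_one (inv_prime_pos p).le hp0)
    rw [coeff_rescale_exp, mul_pow, mul_div_assoc, norm_mul, norm_pow, PadicComplex.norm_prime]
    refine mul_le_of_le_one_right (pow_nonneg (inv_prime_pos p).le _) ?_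
    rw [norm_div, norm_pow, ha, ← norm_pow, ← norm_div]
    exact norm_pow_div_factorial_le_one p hπ n
  have h1 := hsum π rfl
  have h2 := hsum (-π) (norm_neg π)
  have hinj : Function.Injective fun n : ℕ => p * n := fun a b h =>
    Nat.eq_of_mul_eq_mul_left hp.out.pos h
  have hex : ∀ (f : PowerSeries ℂ_[p]) (n : ℕ), n ∉ Set.range (fun n : ℕ => p * n) →
      coeff n (expand p hp.out.ne_zero f) = 0 := by
    intro f n hn
    rw [coeff_expand, if_neg]
    rintro ⟨m, rfl⟩
    exact hn ⟨m, rfl⟩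
  have hcomp : ∀ f : PowerSeries ℂ_[p], ∀ n,
      coeff (p * n) (expand p hp.out.ne_zero f) = coeff n f := by
    intro f n
    rw [coeff_expand, if_pos (dvd_mul_right _ _), Nat.mul_div_cancel_left _ hp.out.pos]
  have h3 : Summable fun n =>
      ‖coeff n (expand p hp.out.ne_zero (rescale (p * -π : ℂ_[p]) (exp ℂ_[p])))‖ := by
    refine (hinj.summable_iff fun n hn => ?_).mp ?_
    · rw [hex _ _ hn, norm_zero]
    · refine h2.congr fun n => ?_
      simp only [Function.comp_apply]
      rw [hcomp]
  have h4 : ∑' n, coeff n (expand p hp.out.ne_zero (rescale (p * -π : ℂ_[p]) (exp ℂ_[p]))) =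
      ∑' n, coeff n (rescale (p * -π : ℂ_[p]) (exp ℂ_[p])) := by
    rw [← hinj.tsum_eq]
    · exact tsum_congr fun n => hcomp _ n
    · intro n hn
      by_contra hn'
      exact hn (hex _ _ hn')
  have hF : Summable fun n => ‖coeff n (dworkSeries p π)‖ := by
    simp only [coeff_dworkSeries p hπ]
    exact summable_norm_dworkCoeff p hπ
  have hpow : dworkSeries p π ^ p = rescale (p * π : ℂ_[p]) (exp ℂ_[p]) *
      expand p hp.out.ne_zero (rescale (p * -π : ℂ_[p]) (exp ℂ_[p])) := by
    rw [dworkSeries, mul_pow, ← map_pow, ← map_pow, ← map_pow, exp_pow_eq_rescale_exp,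
      rescale_rescale, rescale_rescale]
  have hone : rescale (p * π : ℂ_[p]) (exp ℂ_[p]) * rescale (p * -π : ℂ_[p]) (exp ℂ_[p]) = 1 := by
    rw [exp_mul_exp_eq_exp_add]
    simp
  have h5 := (summable_norm_coeff_pow_and_tsum_coeff_pow hF p).2
  have h6 := congrArg (fun f => ∑' n, coeff n f) hone
  simp only [coeff_one] at h6
  rw [tsum_coeff_mul h1 h2, tsum_ite_eq] at h6
  rw [hpow, tsum_coeff_mul h1 h3, h4, h6] at h5
  simp only [coeff_dworkSeries p hπ] at h5
  exact h5.symm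

include hπ in
theorem norm_pi_lt_one : ‖π‖ < 1 := by
  have h2 : p - 1 ≠ 0 := by have := hp.out.two_le; omega
  rw [← pow_lt_one_iff_of_nonneg (norm_nonneg _) h2, norm_pow_prime_sub_one p hπ]
  exact inv_prime_lt_one p

include hπ in
theorem norm_dworkCoeff_le_sq (hp2 : p ≠ 2) {n : ℕ} (hn : 2 ≤ n) :
    ‖dworkCoeff p π n‖ ≤ ‖π‖ ^ 2 := by
  have h3 : 2 ≤ p - 1 := by have := hp.out.two_le; omega
  have hπ1 := norm_pi_lt_one p hπ
  rcases lt_or_ge n p with h | h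
  · have hfac : ‖(n.factorial : ℂ_[p])‖ = 1 := by
      rw [PadicComplex.norm_natCast_eq, Padic.norm_natCast_eq_one_iff, hp.out.coprime_iff_not_dvd,
        hp.out.dvd_factorial]
      omega
    rw [dworkCoeff, norm_div, norm_mul, norm_pow, hfac, div_one]
    refine (mul_le_of_le_one_right (by positivity) (PadicComplex.norm_intCast_le_one p _)).trans ?_
    exact pow_le_pow_of_le_one (norm_nonneg _) hπ1.le hn
  · have h4 := norm_dworkCoeff_le_of_pow_dvd p hπ (n := n) (M := 1)
      (by simpa using prime_dvd_dworkNumber p h)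
    rw [pow_one, ← norm_pow_prime_sub_one p hπ] at h4
    exact h4.trans (pow_le_pow_of_le_one (norm_nonneg _) hπ1.le h3)

include hπ in
theorem norm_dworkValue_sub_le (hp2 : p ≠ 2) : ‖dworkValue p π - (1 + π)‖ ≤ ‖π‖ ^ 2 := by
  have hs := (summable_norm_dworkCoeff p hπ).of_norm
  have h := hs.sum_add_tsum_nat_add 2
  have h01 : ∑ i ∈ Finset.range 2, dworkCoeff p π i = 1 + π := by
    have := hp.out.two_le
    simp [Finset.sum_range_succ, dworkCoeff, dworkNumber_of_lt p (n := 0) (by omega),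
      dworkNumber_of_lt p (n := 1) (by omega)]
  rw [dworkValue, ← h, h01, add_sub_cancel_left]
  exact IsUltrametricDist.norm_tsum_le_of_forall_le_of_nonneg (by positivity)
    fun n => norm_dworkCoeff_le_sq p hπ hp2 (by omega)

theorem dworkCoeff_mul (π a : ℂ_[p]) (n : ℕ) :
    dworkCoeff p (π * a) n = dworkCoeff p π n * a ^ n := by
  rw [dworkCoeff, dworkCoeff, mul_pow]
  ring

end DworkSplitting

section SplittingCharacter

variable (p : ℕ) [hp : Fact p.Prime]

theorem teichmullerChar_apply (x : ZMod p) :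
    teichmullerChar p x = algebraMap ℚ_[p] ℂ_[p] (teichmullerLift p x : ℚ_[p]) := rfl

theorem teichmullerChar_zero : teichmullerChar p 0 = 0 := by
  simp [teichmullerChar_apply, teichmullerLift_zero]

theorem norm_teichmullerChar_sub_natCast_le (x : ZMod p) :
    ‖teichmullerChar p x - (x.val : ℂ_[p])‖ ≤ (p : ℝ)⁻¹ := by
  obtain ⟨z, hz⟩ := prime_dvd_sub_teichmullerLift p (x.val : ℤ_[p])
  rw [map_natCast, ZMod.natCast_zmod_val] at hz
  have h : teichmullerChar p x - (x.val : ℂ_[p]) = algebraMap ℚ_[p] ℂ_[p] ((-(p * z) : ℤ_[p]) : ℚ_[p]) := by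
    rw [← hz, teichmullerChar_apply]
    push_cast
    simp
  rw [h, norm_algebraMap', ← PadicInt.norm_def, norm_neg, norm_mul, PadicInt.norm_p]
  exact mul_le_of_le_one_right (inv_prime_pos p).le (PadicInt.norm_le_one z)

theorem eq_of_norm_teichmullerChar_sub_lt_one {x y : ZMod p}
    (h : ‖teichmullerChar p x - teichmullerChar p y‖ < 1) : x = y := by
  have h1 : teichmullerChar p x - teichmullerChar p y =
      algebraMap ℚ_[p] ℂ_[p] ((teichmullerLift p x - teichmullerLift p y : ℤ_[p]) : ℚ_[p]) := by
    rw [teichmullerChar_apply, teichmullerChar_apply]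
    push_cast
    simp
  rw [h1, norm_algebraMap', ← PadicInt.norm_def, PadicInt.norm_lt_one_iff_dvd,
    ← Ideal.mem_span_singleton, ← PadicInt.maximalIdeal_eq_span_p, ← PadicInt.ker_toZMod,
    RingHom.mem_ker, map_sub, toZMod_teichmullerLift, toZMod_teichmullerLift, sub_eq_zero] at h
  exact h

theorem teichmullerChar_injective : Function.Injective (teichmullerChar p) := fun x y h =>
  eq_of_norm_teichmullerChar_sub_lt_one p (by rw [h, sub_self, norm_zero]; exact one_pos)

theorem teichmullerChar_pow_prime_sub_one {x : ZMod p} (hx : x ≠ 0) :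
    teichmullerChar p x ^ (p - 1) = 1 := by
  rw [← map_pow, ZMod.pow_card_sub_one_eq_one hx, map_one]

theorem orderOf_teichmullerChar : orderOf (teichmullerChar p) = p - 1 := by
  have hp2 := hp.out.two_le
  refine Nat.dvd_antisymm (orderOf_dvd_of_pow_eq_one ?_) ?_
  · ext x
    rw [MulChar.pow_apply_coe, MulChar.one_apply_coe,
      teichmullerChar_pow_prime_sub_one p x.ne_zero]
  · obtain ⟨g, hg⟩ := IsCyclic.exists_ofOrder_eq_natCard (α := (ZMod p)ˣ)
    rw [Nat.card_eq_fintype_card, ZMod.card_units] at hg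
    rw [← hg]
    refine orderOf_dvd_of_pow_eq_one (Units.ext (teichmullerChar_injective p ?_))
    rw [Units.val_pow_eq_pow_val, map_pow, ← MulChar.pow_apply_coe, pow_orderOf_eq_one,
      MulChar.one_apply_coe, Units.val_one, map_one]

variable {π : ℂ_[p]} (hπ : π ^ (p - 1) = -p)

include hπ in
theorem mul_teichmullerChar_pow {x : ZMod p} (hx : x ≠ 0) :
    (π * teichmullerChar p x) ^ (p - 1) = -p := by
  rw [mul_pow, teichmullerChar_pow_prime_sub_one p hx, mul_one, hπ]

theorem norm_teichmullerChar {x : ZMod p} (hx : x ≠ 0) : ‖teichmullerChar p x‖ = 1 := by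
  have hp2 := hp.out.two_le
  have h := congrArg norm (teichmullerChar_pow_prime_sub_one p hx)
  rw [norm_pow, norm_one] at h
  exact (pow_eq_one_iff_of_nonneg (norm_nonneg _) (by omega)).mp h

theorem dworkValue_zero : dworkValue p 0 = 1 := by
  have h : ∀ n, n ≠ 0 → dworkCoeff p (0 : ℂ_[p]) n = 0 := fun n hn => by
    simp [dworkCoeff, hn]
  rw [dworkValue, tsum_eq_single 0 (fun n hn => h n hn)]
  simp [dworkCoeff, dworkNumber]

include hπ in
theorem dworkValue_mul_teichmullerChar_pow_prime (x : ZMod p) :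
    dworkValue p (π * teichmullerChar p x) ^ p = 1 := by
  rcases eq_or_ne x 0 with rfl | hx
  · rw [teichmullerChar_zero, mul_zero, dworkValue_zero, one_pow]
  · exact dworkValue_pow_prime p (mul_teichmullerChar_pow p hπ hx)

include hπ in
theorem norm_dworkValue_mul_teichmullerChar_sub_le (hp2 : p ≠ 2) (x : ZMod p) :
    ‖dworkValue p (π * teichmullerChar p x) - (1 + π * teichmullerChar p x)‖ ≤ ‖π‖ ^ 2 := by
  rcases eq_or_ne x 0 with rfl | hx
  · rw [teichmullerChar_zero, mul_zero, dworkValue_zero, add_zero, sub_self, norm_zero]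
    positivity
  · have h := norm_dworkValue_sub_le p (mul_teichmullerChar_pow p hπ hx) hp2
    rwa [norm_mul π, norm_teichmullerChar p hx, mul_one] at h

theorem PadicComplex.norm_sub_le_max (a b : ℂ_[p]) : ‖a - b‖ ≤ max ‖a‖ ‖b‖ := by
  rw [sub_eq_add_neg, ← norm_neg b]
  exact IsUltrametricDist.norm_add_le_max _ _

theorem norm_sub_le_of_norm_sub_le {a b c : ℂ_[p]} {r : ℝ} (h1 : ‖a - b‖ ≤ r)
    (h2 : ‖a - c‖ ≤ r) : ‖b - c‖ ≤ r := by
  have : b - c = (a - c) - (a - b) := by ring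
  rw [this]
  exact (PadicComplex.norm_sub_le_max p _ _).trans (max_le h2 h1)

include hπ in
theorem eq_of_norm_sub_one_add_mul_le {z : ℂ_[p]} {x y : ZMod p}
    (hx : ‖z - (1 + π * teichmullerChar p x)‖ ≤ ‖π‖ ^ 2)
    (hy : ‖z - (1 + π * teichmullerChar p y)‖ ≤ ‖π‖ ^ 2) : x = y := by
  have h := norm_sub_le_of_norm_sub_le p hx hy
  have e : 1 + π * teichmullerChar p x - (1 + π * teichmullerChar p y) =
      π * (teichmullerChar p x - teichmullerChar p y) := by ring
  rw [e, norm_mul, sq] at h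
  have hπ0 : 0 < ‖π‖ := norm_pos_iff.mpr (ne_zero_of_pow_prime_sub_one p hπ)
  exact eq_of_norm_teichmullerChar_sub_lt_one p
    ((le_of_mul_le_mul_left h hπ0).trans_lt (norm_pi_lt_one p hπ))

include hπ in
theorem exists_dworkValue_eq_of_pow_prime (hp2 : p ≠ 2) {ζ : ℂ_[p]} (hζ : ζ ^ p = 1) :
    ∃ x : ZMod p, dworkValue p (π * teichmullerChar p x) = ζ := by
  classical
  have hinj : Function.Injective fun x : ZMod p => dworkValue p (π * teichmullerChar p x) := by
    intro x y hxy
    have h1 := norm_dworkValue_mul_teichmullerChar_sub_le p hπ hp2 x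
    have h2 := norm_dworkValue_mul_teichmullerChar_sub_le p hπ hp2 y
    simp only at hxy
    rw [← hxy] at h2
    exact eq_of_norm_sub_one_add_mul_le p hπ h1 h2
  have hmem : ∀ z : ℂ_[p], z ∈ Polynomial.nthRootsFinset p (1 : ℂ_[p]) ↔ z ^ p = 1 := fun z =>
    Polynomial.mem_nthRootsFinset hp.out.pos 1
  have hcard : (Polynomial.nthRootsFinset p (1 : ℂ_[p])).card ≤ p :=
    (Multiset.toFinset_card_le _).trans (Polynomial.card_nthRoots p 1)
  have himg : Finset.univ.image (fun x : ZMod p => dworkValue p (π * teichmullerChar p x)) =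
      Polynomial.nthRootsFinset p (1 : ℂ_[p]) := by
    refine Finset.eq_of_subset_of_card_le ?_ ?_
    · intro z hz
      obtain ⟨x, -, rfl⟩ := Finset.mem_image.mp hz
      exact (hmem _).mpr (dworkValue_mul_teichmullerChar_pow_prime p hπ x)
    · rw [Finset.card_image_of_injective _ hinj, Finset.card_univ, ZMod.card]
      exact hcard
  have := (hmem ζ).mpr hζ
  rw [← himg, Finset.mem_image] at this
  obtain ⟨x, -, hx⟩ := this
  exact ⟨x, hx⟩

theorem AddChar.apply_zmod_eq_pow (θ : AddChar (ZMod p) ℂ_[p]) (x : ZMod p) :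
    θ x = θ 1 ^ x.val := by
  rw [← AddChar.map_nsmul_eq_pow]
  simp

theorem AddChar.apply_pow_prime (θ : AddChar (ZMod p) ℂ_[p]) (x : ZMod p) : θ x ^ p = 1 := by
  rw [← AddChar.map_nsmul_eq_pow]
  simp

theorem norm_pow_sub_one_add_mul_le {z π : ℂ_[p]} (hπ1 : ‖π‖ ≤ 1) (h : ‖z - (1 + π)‖ ≤ ‖π‖ ^ 2)
    (n : ℕ) : ‖z ^ n - (1 + π * n)‖ ≤ ‖π‖ ^ 2 := by
  have hz1 : ‖z‖ ≤ 1 := by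
    have e : z = (z - (1 + π)) + (1 + π) := by ring
    rw [e]
    refine (IsUltrametricDist.norm_add_le_max _ _).trans (max_le ?_ ?_)
    · exact h.trans (pow_le_one₀ (norm_nonneg _) hπ1)
    · exact (IsUltrametricDist.norm_add_le_max _ _).trans (max_le norm_one.le hπ1)
  induction n with
  | zero => simp
  | succ n ih =>
    have e : z ^ (n + 1) - (1 + π * (n + 1 : ℕ)) =
        z * (z ^ n - (1 + π * n)) + ((z - (1 + π)) * (1 + π * n) + π ^ 2 * n) := by
      push_cast; ring
    have hn : ‖(n : ℂ_[p])‖ ≤ 1 := by simpa using PadicComplex.norm_intCast_le_one p n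
    have hn' : ‖1 + π * n‖ ≤ 1 := by
      refine (IsUltrametricDist.norm_add_le_max _ _).trans (max_le norm_one.le ?_)
      rw [norm_mul]
      exact mul_le_one₀ hπ1 (norm_nonneg _) hn
    rw [e]
    refine (IsUltrametricDist.norm_add_le_max _ _).trans (max_le ?_
      ((IsUltrametricDist.norm_add_le_max _ _).trans (max_le ?_ ?_)))
    · rw [norm_mul]
      exact (mul_le_of_le_one_left (norm_nonneg _) hz1).trans ih
    · rw [norm_mul]
      exact (mul_le_of_le_one_right (norm_nonneg _) hn').trans h
    · rw [norm_mul, norm_pow]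
      exact mul_le_of_le_one_right (by positivity) hn

/-- Every nontrivial additive character is given by the Dwork series for a suitable `π`. -/
theorem exists_addChar_eq_dworkValue (hp2 : p ≠ 2) {θ : AddChar (ZMod p) ℂ_[p]} (hθ : θ ≠ 1) :
    ∃ π : ℂ_[p], π ^ (p - 1) = -p ∧ ∀ x, θ x = dworkValue p (π * teichmullerChar p x) := by
  have h2 := hp.out.two_le
  obtain ⟨π₀, hπ₀⟩ := IsAlgClosed.exists_pow_nat_eq (-p : ℂ_[p]) (by omega : 0 < p - 1)
  obtain ⟨b, hb⟩ := exists_dworkValue_eq_of_pow_prime p hπ₀ hp2 (AddChar.apply_pow_prime p θ 1)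
  have hb0 : b ≠ 0 := by
    rintro rfl
    rw [teichmullerChar_zero, mul_zero, dworkValue_zero] at hb
    refine hθ (DFunLike.ext _ _ fun x => ?_)
    rw [AddChar.apply_zmod_eq_pow, ← hb, one_pow, AddChar.one_apply]
  have hπ := mul_teichmullerChar_pow p hπ₀ hb0
  set π := π₀ * teichmullerChar p b with hπdef
  have hπ1 := norm_pi_lt_one p hπ
  refine ⟨π, hπ, fun x => ?_⟩
  obtain ⟨y, hy⟩ := exists_dworkValue_eq_of_pow_prime p hπ hp2 (AddChar.apply_pow_prime p θ x)
  have hyn := norm_dworkValue_mul_teichmullerChar_sub_le p hπ hp2 y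
  rw [hy] at hyn
  have hxn : ‖θ x - (1 + π * teichmullerChar p x)‖ ≤ ‖π‖ ^ 2 := by
    have h3 := norm_dworkValue_sub_le p hπ hp2
    rw [hb] at h3
    have h4 := norm_pow_sub_one_add_mul_le p hπ1.le h3 x.val
    rw [← AddChar.apply_zmod_eq_pow] at h4
    have e : θ x - (1 + π * teichmullerChar p x) =
        (θ x - (1 + π * x.val)) - π * (teichmullerChar p x - x.val) := by ring
    rw [e]
    refine (PadicComplex.norm_sub_le_max p _ _).trans (max_le h4 ?_)
    rw [norm_mul, sq]
    refine mul_le_mul_of_nonneg_left ((norm_teichmullerChar_sub_natCast_le p x).trans ?_)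
      (norm_nonneg _)
    rw [← norm_pow_prime_sub_one p hπ]
    exact pow_le_of_le_one (norm_nonneg _) hπ1.le (by omega)
  obtain rfl := eq_of_norm_sub_one_add_mul_le p hπ hxn hyn
  exact hy.symm

end SplittingCharacter

section GrossKoblitz

variable (p : ℕ) [hp : Fact p.Prime]

theorem sum_inv_teichmullerChar_pow_mul_pow (k n : ℕ) :
    ∑ x, (teichmullerChar p ^ k)⁻¹ x * teichmullerChar p x ^ n =
      if n ≡ k [MOD p - 1] then (p : ℂ_[p]) - 1 else 0 := by
  have h1 : ∀ x, (teichmullerChar p ^ k)⁻¹ x * teichmullerChar p x ^ n =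
      ((teichmullerChar p ^ k)⁻¹ * teichmullerChar p ^ n) x := by
    intro x
    rw [MulChar.mul_apply]
    rcases eq_or_ne x 0 with rfl | hx
    · rw [MulChar.map_zero, zero_mul, zero_mul]
    · obtain ⟨u, rfl⟩ := hx.isUnit
      rw [MulChar.pow_apply_coe]
  simp only [h1]
  split_ifs with h
  · have : teichmullerChar p ^ n = teichmullerChar p ^ k := by
      rw [pow_eq_pow_iff_modEq, orderOf_teichmullerChar]; exact h
    rw [this, inv_mul_cancel, MulChar.sum_one_eq_card_units, ZMod.card_units,
      Nat.cast_sub hp.out.one_le, Nat.cast_one]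
  · refine MulChar.sum_eq_zero_of_ne_one fun h2 => h ?_
    rw [inv_mul_eq_one, eq_comm, pow_eq_pow_iff_modEq, orderOf_teichmullerChar] at h2
    exact h2

theorem gaussSum_inv_teichmullerChar_pow_eq_tsum {π : ℂ_[p]} (hπ : π ^ (p - 1) = -p)
    {θ : AddChar (ZMod p) ℂ_[p]} (hθ : ∀ x, θ x = dworkValue p (π * teichmullerChar p x))
    {k : ℕ} (hk : k < p - 1) :
    gaussSum (teichmullerChar p ^ k)⁻¹ θ =
      ((p : ℂ_[p]) - 1) * ∑' m : ℕ, dworkCoeff p π (k + (p - 1) * m) := by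
  have hp2 := hp.out.two_le
  have hnorm : ∀ x : ZMod p, ‖teichmullerChar p x‖ ≤ 1 := by
    intro x
    rcases eq_or_ne x 0 with rfl | hx
    · rw [teichmullerChar_zero, norm_zero]; exact zero_le_one
    · exact (norm_teichmullerChar p hx).le
  have hs : ∀ x : ZMod p, HasSum (fun n => (teichmullerChar p ^ k)⁻¹ x *
      (dworkCoeff p π n * teichmullerChar p x ^ n)) ((teichmullerChar p ^ k)⁻¹ x * θ x) := by
    intro x
    refine HasSum.mul_left _ ?_
    rw [hθ, dworkValue]
    simp only [dworkCoeff_mul]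
    refine Summable.hasSum (Summable.of_norm_bounded (summable_norm_dworkCoeff p hπ) fun n => ?_)
    rw [norm_mul, norm_pow]
    exact mul_le_of_le_one_right (norm_nonneg _) (pow_le_one₀ (norm_nonneg _) (hnorm x))
  have h1 : HasSum (fun n => ∑ x, (teichmullerChar p ^ k)⁻¹ x *
      (dworkCoeff p π n * teichmullerChar p x ^ n)) (gaussSum (teichmullerChar p ^ k)⁻¹ θ) :=
    hasSum_sum fun x _ => hs x
  have h2 : ∀ n, ∑ x, (teichmullerChar p ^ k)⁻¹ x *
      (dworkCoeff p π n * teichmullerChar p x ^ n) =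
      dworkCoeff p π n * if n ≡ k [MOD p - 1] then (p : ℂ_[p]) - 1 else 0 := by
    intro n
    rw [← sum_inv_teichmullerChar_pow_mul_pow p k n, Finset.mul_sum]
    exact Finset.sum_congr rfl fun x _ => by ring
  simp only [h2] at h1
  have hinj : Function.Injective fun m : ℕ => k + (p - 1) * m := fun a b h =>
    Nat.eq_of_mul_eq_mul_left (by omega : 0 < p - 1) (Nat.add_left_cancel h)
  have hzero : ∀ n, n ∉ Set.range (fun m : ℕ => k + (p - 1) * m) →
      dworkCoeff p π n * (if n ≡ k [MOD p - 1] then (p : ℂ_[p]) - 1 else 0) = 0 := by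
    intro n hn
    rw [if_neg, mul_zero]
    intro h
    refine hn ⟨n / (p - 1), ?_⟩
    have h3 : n % (p - 1) = k := by rw [h, Nat.mod_eq_of_lt hk]
    simp only
    rw [← h3, Nat.mod_add_div]
  rw [← hinj.hasSum_iff hzero] at h1
  have h3 := (summable_norm_dworkCoeff_progression p hπ k).of_norm.hasSum.mul_left
    ((p : ℂ_[p]) - 1)
  refine HasSum.unique (h1.congr_fun fun m => ?_) h3
  simp only [Function.comp_apply]
  rw [if_pos (by simp [Nat.ModEq]), mul_comm]

/-- The Gross–Koblitz formula over the prime field. -/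
theorem exists_gaussSum_inv_teichmullerChar_pow {θ : AddChar (ZMod p) ℂ_[p]} (hθ : θ ≠ 1) :
    ∃ π : ℂ_[p], π ^ (p - 1) = -p ∧ ∀ (k : ℕ) (s : ℤ_[p]), k < p - 1 →
      ((p : ℤ_[p]) - 1) * s = k →
      gaussSum (teichmullerChar p ^ k)⁻¹ θ =
        -(π ^ k * algebraMap ℚ_[p] ℂ_[p] (padicGamma p s)) := by
  have hp2 := hp.out.two_le
  rcases eq_or_ne p 2 with h2 | h2
  · refine ⟨-p, ?_, fun k s hk hs => ?_⟩
    · have : p - 1 = 1 := by omega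
      rw [this, pow_one]
    · obtain rfl : k = 0 := by omega
      rw [Nat.cast_zero, (isUnit_prime_sub_one p).mul_right_eq_zero] at hs
      rw [hs, padicGamma_zero, pow_zero, inv_one, gaussSum_one_left hθ]
      simp
  · obtain ⟨π, hπ, hval⟩ := exists_addChar_eq_dworkValue p h2 hθ
    refine ⟨π, hπ, fun k s hk hs => ?_⟩
    rw [gaussSum_inv_teichmullerChar_pow_eq_tsum p hπ hval hk,
      ← one_sub_prime_mul_tsum_dworkCoeff p hπ (by omega) hs]
    ring

end GrossKoblitz

section RationalArguments

variable (p : ℕ) [hp : Fact p.Prime]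

theorem ratToPadicInt_eq {r : ℚ} {x : ℤ_[p]} (h : (x : ℚ_[p]) = r) : ratToPadicInt p r = x := by
  have h1 : ‖(r : ℚ_[p])‖ ≤ 1 := by rw [← h]; exact x.2
  unfold ratToPadicInt
  exact (dif_pos h1).trans (PadicInt.ext h.symm)

theorem padicGammaRat_eq {r : ℚ} {x : ℤ_[p]} (h : (x : ℚ_[p]) = r) :
    padicGammaRat p r = algebraMap ℚ_[p] ℂ_[p] (padicGamma p x) := by
  rw [padicGammaRat, ratToPadicInt_eq p h]

theorem padicGammaRat_ne_zero (r : ℚ) : padicGammaRat p r ≠ 0 := by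
  rw [padicGammaRat, Ne, map_eq_zero_iff _ (algebraMap ℚ_[p] ℂ_[p]).injective,
    PadicInt.coe_eq_zero]
  exact (isUnit_padicGamma p _).ne_zero

theorem coe_eq_div_prime_sub_one {s : ℤ_[p]} {k : ℕ} (hs : ((p : ℤ_[p]) - 1) * s = k) :
    (s : ℚ_[p]) = ((k / (p - 1) : ℚ) : ℚ_[p]) := by
  have h0 : (p : ℚ_[p]) - 1 ≠ 0 := by
    rw [sub_ne_zero]; exact_mod_cast hp.out.ne_one
  have h := congrArg (fun x : ℤ_[p] => (x : ℚ_[p])) hs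
  push_cast at h ⊢
  rw [eq_div_iff h0, ← h, mul_comm]

theorem exists_prime_sub_one_mul_eq (k : ℕ) : ∃ s : ℤ_[p], ((p : ℤ_[p]) - 1) * s = k := by
  obtain ⟨u, hu⟩ := isUnit_prime_sub_one p
  exact ⟨↑u⁻¹ * k, by rw [← hu, Units.mul_inv_cancel_left]⟩

theorem coe_eq_one_div_natCast {ν : ℤ_[p]} {n : ℕ} (hν : (n : ℤ_[p]) * ν = 1) :
    (ν : ℚ_[p]) = (n : ℚ_[p])⁻¹ := by
  have h := congrArg (fun x : ℤ_[p] => (x : ℚ_[p])) hν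
  push_cast at h
  exact eq_inv_of_mul_eq_one_right h

end RationalArguments

section FractionalParts

@[to_additive]
theorem prod_range_add_natCast_zmod {R : Type*} [CommMonoid R] (n : ℕ) [NeZero n] (c : ZMod n)
    (f : ZMod n → R) : ∏ j ∈ Finset.range n, f (c + j) = ∏ j ∈ Finset.range n, f j := by
  have h : ∀ g : ZMod n → R, ∏ j ∈ Finset.range n, g j = ∏ x, g x := fun g =>
    Finset.prod_bij' (fun j _ => ((j : ℕ) : ZMod n)) (fun x _ => x.val)
      (by simp) (fun x _ => by simpa using ZMod.val_lt x)
      (fun j hj => by simp [ZMod.val_natCast, Nat.mod_eq_of_lt (Finset.mem_range.mp hj)])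
      (by simp) (by simp)
  rw [h f, h fun x => f (c + x)]
  exact Equiv.prod_comp (Equiv.addLeft c) f

theorem fract_add_div_natCast {n : ℕ} [NeZero n] {x : ℚ} (hx0 : 0 ≤ x) (hx1 : x < 1) (j : ℤ) :
    Int.fract ((j + x) / n) = (x + ((j : ZMod n).val : ℚ)) / n := by
  have hn : (0 : ℚ) < n := by exact_mod_cast Nat.pos_of_ne_zero (NeZero.ne n)
  have hlt := ZMod.val_lt (j : ZMod n)
  have hlt' : ((j : ZMod n).val : ℚ) + 1 ≤ n := by exact_mod_cast hlt
  rw [Int.fract_eq_iff]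
  refine ⟨by positivity, ?_, j / n, ?_⟩
  · rw [div_lt_one hn]; linarith
  · have h1 : (((j : ZMod n).val : ℤ) : ℚ) = ((j % n : ℤ) : ℚ) := by rw [ZMod.val_intCast]
    have h2 : ((j : ℤ) : ℚ) = n * (j / n : ℤ) + (j % n : ℤ) := by
      exact_mod_cast (Int.mul_ediv_add_emod j n).symm
    rw [Int.cast_natCast] at h1
    rw [h1]
    field_simp
    rw [h2]
    ring

@[to_additive]
theorem prod_comp_fract_shift {M : Type*} [CommMonoid M] (G : ℚ → M) {n : ℕ} (hn : n ≠ 0)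
    {x κ : ℚ} (hx0 : 0 ≤ x) (hx1 : x < 1) {q : ℤ} (hκ : n * κ = q - x) :
    ∏ h ∈ Finset.range n, G (Int.fract (((h + 1 : ℕ) : ℚ) / n - κ)) =
      ∏ h ∈ Finset.range n, G ((x + h) / n) := by
  have : NeZero n := ⟨hn⟩
  have hn0 : (n : ℚ) ≠ 0 := by exact_mod_cast hn
  have h1 := prod_range_add_natCast_zmod n (((1 - q : ℤ)) : ZMod n)
    (fun z => G ((x + (z.val : ℚ)) / n))
  calc _ = _ := Finset.prod_congr rfl fun h _ => ?_
    _ = _ := h1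
    _ = _ := Finset.prod_congr rfl fun h hh => ?_
  · have e : ((h + 1 : ℕ) : ℚ) / n - κ = (((1 - q + h : ℤ) : ℚ) + x) / n := by
      field_simp
      push_cast
      linear_combination -hκ
    rw [e, fract_add_div_natCast hx0 hx1]
    push_cast
    rfl
  · rw [ZMod.val_natCast, Nat.mod_eq_of_lt (Finset.mem_range.mp hh)]

theorem sum_neg_floor_natCast_div_sub {n : ℕ} (hn : n ≠ 0) {x κ : ℚ} (hx0 : 0 ≤ x) (hx1 : x < 1)
    {q : ℤ} (hκ : n * κ = q - x) :
    ∑ h ∈ Finset.range n, -⌊((h + 1 : ℕ) : ℚ) / n - κ⌋ = q - 1 := by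
  have hn0 : (n : ℚ) ≠ 0 := by exact_mod_cast hn
  have h1 := sum_comp_fract_shift (fun y => y) hn hx0 hx1 hκ
  have h2 : (∑ h ∈ Finset.range n, (-⌊((h + 1 : ℕ) : ℚ) / n - κ⌋ : ℚ)) = q - 1 := by
    have h3 : ∀ y : ℚ, -(⌊y⌋ : ℚ) = Int.fract y - y := fun y => by
      rw [← Int.self_sub_floor]; ring
    simp only [h3]
    rw [Finset.sum_sub_distrib, h1, ← Finset.sum_sub_distrib]
    have h4 : ∀ h : ℕ, (x + h) / n - (((h + 1 : ℕ) : ℚ) / n - κ) = (x - 1) / n + κ := by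
      intro h; push_cast; field_simp; ring
    simp only [h4]
    rw [Finset.sum_const, Finset.card_range, nsmul_eq_mul]
    field_simp
    linear_combination hκ
  exact_mod_cast h2

end FractionalParts

theorem prod_zpow_eq_zpow_sum {K ι : Type*} [Field K] {a : K} (ha : a ≠ 0) (s : Finset ι)
    (e : ι → ℤ) : ∏ i ∈ s, a ^ e i = a ^ ∑ i ∈ s, e i := by
  classical
  induction s using Finset.induction_on with
  | empty => simp
  | insert i s hi ih => rw [Finset.prod_insert hi, Finset.sum_insert hi, zpow_add₀ ha, ih]

section CharacterSums

variable (p : ℕ) [hp : Fact p.Prime]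

/-- The factor of the Gamma quotient attached to the rational number `a` and the index `k`. -/
noncomputable def gammaFactor (k : ℕ) (a : ℚ) : ℂ_[p] :=
  padicGammaRat p (Int.fract (a - k / ((p : ℚ) - 1))) /
    (padicGammaRat p a * padicGammaRat p (1 - k / ((p : ℚ) - 1))) *
    (-1) ^ k * (-(p : ℂ_[p])) ^ hypNu p k (a * ((p : ℚ) - 1))

theorem hypNu_mul_prime_sub_one (k : ℕ) (a : ℚ) :
    hypNu p k (a * ((p : ℚ) - 1)) = -⌊a - k / ((p : ℚ) - 1)⌋ := by
  have h0 : (p : ℚ) - 1 ≠ 0 := by rw [sub_ne_zero]; exact_mod_cast hp.out.ne_one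
  rw [hypNu, sub_div, mul_div_cancel_right₀ _ h0]

theorem prime_ne_zero_complex : (-(p : ℂ_[p])) ≠ 0 :=
  neg_ne_zero.mpr (by exact_mod_cast hp.out.ne_zero)

theorem gammaFactor_ne_zero (k : ℕ) (a : ℚ) : gammaFactor p k a ≠ 0 := by
  refine mul_ne_zero (mul_ne_zero (div_ne_zero (padicGammaRat_ne_zero p _)
    (mul_ne_zero (padicGammaRat_ne_zero p _) (padicGammaRat_ne_zero p _))) ?_) ?_
  · exact pow_ne_zero _ (neg_ne_zero.mpr one_ne_zero)
  · exact zpow_ne_zero _ (prime_ne_zero_complex p)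

theorem gammaFactor_eq {k : ℕ} (hk : k < p - 1) {s : ℤ_[p]} (hs : ((p : ℤ_[p]) - 1) * s = k)
    (a : ℚ) : gammaFactor p k a =
      padicGammaRat p (Int.fract (a - k / ((p : ℚ) - 1))) / padicGammaRat p a *
        (-algebraMap ℚ_[p] ℂ_[p] (padicGamma p s)) *
        (-(p : ℂ_[p])) ^ (-⌊a - k / ((p : ℚ) - 1)⌋) := by
  have h1 : padicGammaRat p (1 - k / ((p : ℚ) - 1)) =
      algebraMap ℚ_[p] ℂ_[p] (padicGamma p (1 - s)) := by
    refine padicGammaRat_eq p ?_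
    rw [PadicInt.coe_sub, coe_eq_div_prime_sub_one p hs]
    push_cast
    rfl
  have h2 := congrArg (fun x : ℤ_[p] => algebraMap ℚ_[p] ℂ_[p] x)
    (padicGamma_mul_padicGamma_one_sub p hk hs)
  simp only [PadicInt.coe_mul, PadicInt.coe_neg, PadicInt.coe_pow, PadicInt.coe_one, map_mul,
    map_neg, map_pow, map_one] at h2
  rw [← h1] at h2
  have h3 := padicGammaRat_ne_zero p (1 - k / ((p : ℚ) - 1))
  have h4 : (-1 : ℂ_[p]) ^ k / padicGammaRat p (1 - k / ((p : ℚ) - 1)) =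
      -algebraMap ℚ_[p] ℂ_[p] (padicGamma p s) := by
    rw [div_eq_iff h3, neg_mul, h2, neg_neg]
  rw [gammaFactor, hypNu_mul_prime_sub_one, ← h4]
  congr 1
  rw [← div_div]
  ring

theorem prod_range_succ_padicGammaRat_div {n : ℕ} (hn : n ≠ 0) :
    ∏ h ∈ Finset.range n, padicGammaRat p (((h + 1 : ℕ) : ℚ) / n) =
      -∏ h ∈ Finset.range n, padicGammaRat p ((h : ℚ) / n) := by
  have hn0 : (n : ℚ) ≠ 0 := by exact_mod_cast hn
  have h1 := Finset.prod_range_succ (fun h : ℕ => padicGammaRat p ((h : ℚ) / n)) n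
  rw [Finset.prod_range_succ'] at h1
  have h2 : padicGammaRat p ((n : ℚ) / n) = -1 := by
    rw [div_self hn0, padicGammaRat_eq p (x := 1) (by simp), padicGamma_one]
    simp
  have h3 : padicGammaRat p (((0 : ℕ) : ℚ) / n) = 1 := by
    rw [padicGammaRat_eq p (x := 0) (by simp), padicGamma_zero]
    simp
  rw [h2, h3, mul_one] at h1
  rw [h1, mul_neg_one]

theorem gaussSum_pow_mul_eq_prod_gammaFactor {θ : AddChar (ZMod p) ℂ_[p]} (hθ : θ ≠ 1) {k : ℕ}
    (hk : k < p - 1) {n : ℕ} (hn : ¬ p ∣ n) :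
    gaussSum ((teichmullerChar p ^ k) ^ n) θ *
        (teichmullerChar p ^ k) ((n : ZMod p) ^ (-(n : ℤ))) *
        gaussSum (teichmullerChar p ^ k)⁻¹ θ ^ n =
      -p * ∏ h ∈ Finset.range n, gammaFactor p k (((h + 1 : ℕ) : ℚ) / n) := by
  obtain ⟨π, hπ, hGK⟩ := exists_gaussSum_inv_teichmullerChar_pow p hθ
  have hp2 := hp.out.two_le
  have hp1 : 0 < p - 1 := by omega
  have hn0 : n ≠ 0 := fun h => hn (h ▸ dvd_zero p)
  have hnp : (n : ZMod p) ≠ 0 := by rwa [Ne, ZMod.natCast_eq_zero_iff]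
  obtain ⟨s, hs⟩ := exists_prime_sub_one_mul_eq p k
  obtain ⟨r, hrlt, q, hq⟩ : ∃ r < p - 1, p - 1 ∣ k * n + r := by
    refine ⟨k * n * (p - 2) % (p - 1), Nat.mod_lt _ hp1, ?_⟩
    rw [Nat.dvd_iff_mod_eq_zero, Nat.add_mod_mod]
    nth_rw 1 [← mul_one (k * n)]
    rw [← mul_add, show 1 + (p - 2) = p - 1 by omega, Nat.mul_mod_left]
  obtain ⟨y, hy⟩ := exists_prime_sub_one_mul_eq p r
  obtain ⟨ν, hν⟩ : ∃ ν : ℤ_[p], (n : ℤ_[p]) * ν = 1 :=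
    ((PadicInt.isUnit_natCast_iff p n).mpr hn).exists_right_inv
  have hτ : teichmullerChar p ^ (k * n + r) = 1 := by
    rw [hq, ← orderOf_teichmullerChar p, pow_mul, pow_orderOf_eq_one, one_pow]
  have hchar : (teichmullerChar p ^ k) ^ n = (teichmullerChar p ^ r)⁻¹ := by
    rw [eq_inv_iff_mul_eq_one, ← pow_mul, ← pow_add, hτ]
  have hval : (teichmullerChar p ^ k) ((n : ZMod p) ^ (-(n : ℤ))) =
      teichmullerChar p n ^ r := by
    obtain ⟨u, hu⟩ := hnp.isUnit
    have h1 : (teichmullerChar p n) ^ (k * n + r) = 1 := by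
      rw [← hu, ← MulChar.pow_apply_coe, hτ, MulChar.one_apply_coe]
    have h2 : (teichmullerChar p ^ k) ((n : ZMod p) ^ (-(n : ℤ))) * teichmullerChar p n ^ (k * n) =
        1 := by
      have h3 : (teichmullerChar p n) ^ (k * n) = (teichmullerChar p ^ k) ((n : ZMod p) ^ n) := by
        rw [map_pow, ← hu, MulChar.pow_apply_coe, ← pow_mul]
      rw [h3, ← map_mul, zpow_neg, zpow_natCast, inv_mul_cancel₀ (pow_ne_zero _ hnp), map_one]
    have h4 : (teichmullerChar p n) ^ (k * n) ≠ 0 := right_ne_zero_of_mul_eq_one h2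
    refine mul_right_cancel₀ h4 ?_
    rw [h2, ← pow_add, add_comm, h1]
  have hmul := congrArg (fun x : ℤ_[p] => algebraMap ℚ_[p] ℂ_[p] x)
    (prod_padicGamma_div_natCast p hν hrlt.le hy)
  have hcoe : ∀ f : ℕ → ℤ_[p], algebraMap ℚ_[p] ℂ_[p] ((∏ h ∈ Finset.range n, f h : ℤ_[p]) : ℚ_[p]) =
      ∏ h ∈ Finset.range n, algebraMap ℚ_[p] ℂ_[p] (f h) := fun f =>
    map_prod ((algebraMap ℚ_[p] ℂ_[p]).comp PadicInt.Coe.ringHom) f _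
  simp only [PadicInt.coe_mul, PadicInt.coe_pow, map_mul, map_pow, hcoe] at hmul
  rw [← teichmullerChar_apply] at hmul
  set x : ℚ := r / ((p : ℚ) - 1) with hx
  set κ : ℚ := k / ((p : ℚ) - 1) with hκ
  have hpq : (0 : ℚ) < (p : ℚ) - 1 := by
    have : (1 : ℚ) < p := by exact_mod_cast hp.out.one_lt
    linarith
  have hpc : ((p - 1 : ℕ) : ℚ) = (p : ℚ) - 1 := by rw [Nat.cast_sub hp.out.one_le, Nat.cast_one]
  have hx0 : 0 ≤ x := by positivity
  have hx1 : x < 1 := by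
    rw [hx, div_lt_one hpq, ← hpc]; exact_mod_cast hrlt
  have hκx : n * κ = ((q : ℤ) : ℚ) - x := by
    have h1 : (k : ℚ) * n + r = ((p : ℚ) - 1) * q := by rw [← hpc]; exact_mod_cast hq
    rw [hκ, hx]
    field_simp
    push_cast
    linear_combination h1
  have hG1 : ∀ h : ℕ, algebraMap ℚ_[p] ℂ_[p] (padicGamma p (ν * (y + h))) =
      padicGammaRat p ((x + h) / n) := by
    intro h
    refine (padicGammaRat_eq p ?_).symm
    rw [PadicInt.coe_mul, PadicInt.coe_add, coe_eq_one_div_natCast p hν,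
      coe_eq_div_prime_sub_one p hy, PadicInt.coe_natCast, hx]
    push_cast
    ring
  have hG2 : ∀ h : ℕ, algebraMap ℚ_[p] ℂ_[p] (padicGamma p (ν * h)) =
      padicGammaRat p (h / n) := by
    intro h
    refine (padicGammaRat_eq p ?_).symm
    rw [PadicInt.coe_mul, coe_eq_one_div_natCast p hν, PadicInt.coe_natCast]
    push_cast
    rw [div_eq_mul_inv, mul_comm]
  simp only [hG1, hG2] at hmul
  have hpow : π ^ (k * n + r) = (-p) ^ q := by rw [hq, pow_mul, hπ]
  have hE : ∏ h ∈ Finset.range n, padicGammaRat p ((h : ℚ) / n) ≠ 0 :=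
    Finset.prod_ne_zero_iff.mpr fun h _ => padicGammaRat_ne_zero p _
  have hfloor := sum_neg_floor_natCast_div_sub hn0 hx0 hx1 hκx
  have hp0 := prime_ne_zero_complex p
  have hzpow : ∏ h ∈ Finset.range n, (-(p : ℂ_[p])) ^ (-⌊((h + 1 : ℕ) : ℚ) / n - κ⌋) =
      (-(p : ℂ_[p])) ^ ((q : ℤ) - 1) := by
    rw [← hfloor, prod_zpow_eq_zpow_sum hp0]
  simp only [gammaFactor_eq p hk hs]
  rw [Finset.prod_mul_distrib, Finset.prod_mul_distrib, Finset.prod_div_distrib, hzpow,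
    prod_comp_fract_shift (padicGammaRat p) hn0 hx0 hx1 hκx,
    prod_range_succ_padicGammaRat_div p hn0, Finset.prod_const, Finset.card_range, hmul,
    hchar, hval, hGK k s hk hs, hGK r y hrlt hy, zpow_sub_one₀ hp0, zpow_natCast, ← hpow,
    pow_add, pow_mul]
  rw [neg_pow (π ^ k * _), mul_pow, neg_pow (algebraMap ℚ_[p] ℂ_[p] (padicGamma p s))]
  have hpc0 : (p : ℂ_[p]) ≠ 0 := neg_ne_zero.mp hp0
  field_simp

end CharacterSums

section MoebiusInversion

theorem sum_moebius_div_divisors {d : ℕ} (hd : 1 < d) :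
    ∑ n ∈ d.divisors, ArithmeticFunction.moebius (d / n) = 0 := by
  have h := (ArithmeticFunction.sum_eq_iff_sum_mul_moebius_eq (R := ℤ)
    (f := fun n => if n = 1 then 1 else 0) (g := fun _ => 1)).mp
    (fun n hn => by simp [hn.ne']) d (by omega)
  simp only [Int.cast_id, mul_one] at h
  rw [Nat.sum_divisorsAntidiagonal' (fun a _ => ArithmeticFunction.moebius a)] at h
  simpa [hd.ne'] using h

theorem sum_mul_moebius_div_divisors {d : ℕ} (hd : 0 < d) :
    ∑ n ∈ d.divisors, (n : ℤ) * ArithmeticFunction.moebius (d / n) = Nat.totient d := by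
  have h := (ArithmeticFunction.sum_eq_iff_sum_mul_moebius_eq (R := ℤ)
    (f := fun n => (Nat.totient n : ℤ)) (g := fun n => n)).mp
    (fun n _ => by exact_mod_cast Nat.sum_totient n) d hd
  simp only [Int.cast_id] at h
  rw [Nat.sum_divisorsAntidiagonal' (fun a b => ArithmeticFunction.moebius a * (b : ℤ))] at h
  rw [← h]
  exact Finset.sum_congr rfl fun n _ => mul_comm _ _

theorem prod_reducedFractions {K : Type*} [CommMonoid K] (f : ℚ → K) (d : ℕ) :
    ((reducedFractions d).map f).prod =
      ∏ l ∈ (Finset.Icc 1 d).filter fun l => Nat.Coprime l d, f ((l : ℚ) / d) := by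
  rw [reducedFractions, Multiset.map_map]
  rfl

theorem prod_divisors_prod_reducedFractions {K : Type*} [CommMonoid K] (f : ℚ → K) {n : ℕ}
    (hn : 0 < n) : ∏ d ∈ n.divisors, ((reducedFractions d).map f).prod =
      ∏ h ∈ Finset.range n, f (((h + 1 : ℕ) : ℚ) / n) := by
  have hr : ∏ h ∈ Finset.range n, f (((h + 1 : ℕ) : ℚ) / n) =
      ∏ h ∈ Finset.Icc 1 n, f ((h : ℚ) / n) := by
    rw [Finset.range_eq_Ico, Finset.prod_Ico_add' (fun h : ℕ => f ((h : ℚ) / n))]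
    rfl
  rw [hr]
  simp_rw [prod_reducedFractions]
  rw [Finset.prod_sigma']
  refine Finset.prod_bij' (fun x _ => x.2 * (n / x.1))
    (fun h _ => ⟨n / Nat.gcd h n, h / Nat.gcd h n⟩) ?_ ?_ ?_ ?_ ?_
  · rintro ⟨d, l⟩ hx
    simp only [Finset.mem_sigma, Nat.mem_divisors, Finset.mem_filter, Finset.mem_Icc] at hx ⊢
    obtain ⟨⟨⟨c, rfl⟩, -⟩, ⟨h1, h2⟩, -⟩ := hx
    have hd : 0 < d := by omega
    rw [Nat.mul_div_cancel_left _ hd]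
    have hc : 0 < c := Nat.pos_of_mul_pos_left hn
    exact ⟨Nat.mul_pos h1 hc, Nat.mul_le_mul_right _ h2⟩
  · intro h hh
    simp only [Finset.mem_sigma, Nat.mem_divisors, Finset.mem_filter, Finset.mem_Icc] at hh ⊢
    have hg : 0 < Nat.gcd h n := Nat.gcd_pos_of_pos_right _ hn
    refine ⟨⟨Nat.div_dvd_of_dvd (Nat.gcd_dvd_right h n), hn.ne'⟩,
      ⟨Nat.div_pos (Nat.le_of_dvd hh.1 (Nat.gcd_dvd_left h n)) hg,
        Nat.div_le_div_right hh.2⟩, Nat.coprime_div_gcd_div_gcd hg⟩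
  · rintro ⟨d, l⟩ hx
    simp only [Finset.mem_sigma, Nat.mem_divisors, Finset.mem_filter, Finset.mem_Icc] at hx
    obtain ⟨⟨⟨c, rfl⟩, -⟩, ⟨h1, h2⟩, h3⟩ := hx
    have hd : 0 < d := by omega
    have hc : 0 < c := Nat.pos_of_mul_pos_left hn
    simp only [Nat.mul_div_cancel_left _ hd, Nat.gcd_mul_right, h3.gcd_eq_one, one_mul,
      Nat.mul_div_cancel _ hc]
  · intro h hh
    simp only [Finset.mem_Icc] at hh
    rw [Nat.div_div_self (Nat.gcd_dvd_right h n) hn.ne', Nat.div_mul_cancel (Nat.gcd_dvd_left h n)]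
  · rintro ⟨d, l⟩ hx
    simp only [Finset.mem_sigma, Nat.mem_divisors, Finset.mem_filter, Finset.mem_Icc] at hx
    obtain ⟨⟨⟨c, rfl⟩, -⟩, ⟨h1, h2⟩, h3⟩ := hx
    have hd : 0 < d := by omega
    have hc : 0 < c := Nat.pos_of_mul_pos_left hn
    have hc' : (c : ℚ) ≠ 0 := by exact_mod_cast hc.ne'
    simp only [Nat.mul_div_cancel_left _ hd]
    push_cast
    rw [mul_div_mul_right _ _ hc']

end MoebiusInversion

section

variable (p : ℕ) [hp : Fact p.Prime]

theorem gaussSum_inv_teichmullerChar_pow_ne_zero {θ : AddChar (ZMod p) ℂ_[p]} (hθ : θ ≠ 1) {k : ℕ}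
    (hk : k < p - 1) : gaussSum (teichmullerChar p ^ k)⁻¹ θ ≠ 0 := by
  intro h
  have h1 := gaussSum_pow_mul_eq_prod_gammaFactor p hθ hk (n := 1) hp.out.not_dvd_one
  rw [h] at h1
  simp only [pow_one, mul_zero] at h1
  refine mul_ne_zero (prime_ne_zero_complex p) (Finset.prod_ne_zero_iff.mpr fun h _ =>
    gammaFactor_ne_zero p k _) h1.symm

theorem gaussSumS_eq_prod_gammaFactor {θ : AddChar (ZMod p) ℂ_[p]} (hθ : θ ≠ 1) {k : ℕ}
    (hk : k < p - 1) {d : ℕ} (hd : 1 < d) (hpd : ¬ p ∣ d) :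
    gaussSumS θ d (teichmullerChar p ^ k) =
      ((reducedFractions d).map (gammaFactor p k)).prod := by
  set g := gaussSum (teichmullerChar p ^ k)⁻¹ θ with hg
  have hg0 : g ≠ 0 := gaussSum_inv_teichmullerChar_pow_ne_zero p hθ hk
  let G : ℕ → ℂ_[p] := fun n => ∏ h ∈ Finset.range n, gammaFactor p k (((h + 1 : ℕ) : ℚ) / n)
  have hG : ∀ n, G n ≠ 0 := fun n =>
    Finset.prod_ne_zero_iff.mpr fun h _ => gammaFactor_ne_zero p k _
  have hinv := (ArithmeticFunction.prod_eq_iff_prod_pow_moebius_eq_of_nonzero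
    (f := fun n => ((reducedFractions n).map (gammaFactor p k)).prod) (g := G)
    (fun n _ => by
      rw [prod_reducedFractions]
      exact Finset.prod_ne_zero_iff.mpr fun h _ => gammaFactor_ne_zero p k _)
    (fun n _ => hG n)).mp (fun n hn => prod_divisors_prod_reducedFractions _ hn) d (by omega)
  rw [Nat.prod_divisorsAntidiagonal'
    (fun a b => G b ^ ArithmeticFunction.moebius a)] at hinv
  rw [← hinv, gaussSumS, ← hg]
  have hterm : ∀ n ∈ d.divisors,
      (gaussSum ((teichmullerChar p ^ k) ^ n) θ *
        (teichmullerChar p ^ k) ((n : ZMod p) ^ (-(n : ℤ)))) ^ ArithmeticFunction.moebius (d / n) =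
      (-(p : ℂ_[p])) ^ ArithmeticFunction.moebius (d / n) *
        G n ^ ArithmeticFunction.moebius (d / n) *
        (g ^ ((n : ℤ) * ArithmeticFunction.moebius (d / n)))⁻¹ := by
    intro n hn
    have hpn : ¬ p ∣ n := fun h => hpd (h.trans (Nat.dvd_of_mem_divisors hn))
    have h := gaussSum_pow_mul_eq_prod_gammaFactor p hθ hk hpn
    rw [← eq_div_iff (pow_ne_zero n hg0)] at h
    rw [h, div_zpow, mul_zpow, zpow_mul, zpow_natCast, div_eq_mul_inv]
  rw [Finset.prod_congr rfl hterm, Finset.prod_mul_distrib, Finset.prod_mul_distrib,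
    Finset.prod_inv_distrib, prod_zpow_eq_zpow_sum (prime_ne_zero_complex p),
    prod_zpow_eq_zpow_sum hg0, sum_moebius_div_divisors hd,
    sum_mul_moebius_div_divisors (by omega), zpow_zero, one_mul, zpow_natCast, mul_comm,
    mul_assoc, inv_mul_cancel₀ (pow_ne_zero _ hg0), mul_one]

end

section GaloisClosure

theorem reducedFractions_mem {d : ℕ} {a : ℚ} :
    a ∈ reducedFractions d ↔ ∃ l : ℕ, (1 ≤ l ∧ l ≤ d) ∧ Nat.Coprime l d ∧ (l : ℚ) / d = a := by
  simp [reducedFractions, and_assoc]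

theorem reducedFractions_nodup (d : ℕ) : (reducedFractions d).Nodup := by
  rcases Nat.eq_zero_or_pos d with rfl | hd
  · simp [reducedFractions]
  · refine Multiset.Nodup.map (fun a b h => ?_) (Finset.nodup _)
    have hd' : (d : ℚ) ≠ 0 := by exact_mod_cast hd.ne'
    exact_mod_cast (div_left_inj' hd').mp h

theorem mem_reducedFractions_bounds {d : ℕ} {a : ℚ} (h : a ∈ reducedFractions d) :
    0 < a ∧ a ≤ 1 := by
  obtain ⟨l, ⟨h1, h2⟩, -, rfl⟩ := reducedFractions_mem.mp h
  have h1' : (1 : ℚ) ≤ l := by exact_mod_cast h1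
  have h2' : (l : ℚ) ≤ d := by exact_mod_cast h2
  exact ⟨div_pos (by linarith) (by linarith), div_le_one_of_le₀ h2' (by linarith)⟩

theorem den_of_mem_reducedFractions {d : ℕ} {a : ℚ} (h : a ∈ reducedFractions d) :
    a.den = d := by
  obtain ⟨l, ⟨h1, h2⟩, h3, rfl⟩ := reducedFractions_mem.mp h
  have h := Rat.den_div_eq_of_coprime (a := (l : ℤ)) (b := (d : ℤ))
    (by exact_mod_cast h1.trans h2) (by simpa using h3)
  simp only [Int.cast_natCast] at h
  exact_mod_cast h

theorem one_div_mem_reducedFractions {d : ℕ} (hd : 0 < d) : 1 / (d : ℚ) ∈ reducedFractions d :=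
  reducedFractions_mem.mpr ⟨1, ⟨le_rfl, hd⟩, Nat.coprime_one_left d, by simp⟩

theorem exp_two_pi_mul_I_injOn {a b : ℚ} (ha : 0 < a ∧ a ≤ 1) (hb : 0 < b ∧ b ≤ 1)
    (h : Complex.exp (2 * Real.pi * Complex.I * (a : ℂ)) =
      Complex.exp (2 * Real.pi * Complex.I * (b : ℂ))) : a = b := by
  obtain ⟨n, hn⟩ := Complex.exp_eq_exp_iff_exists_int.mp h
  have h1 : (a : ℂ) = b + n := by
    have h2 := Complex.two_pi_I_ne_zero
    refine mul_left_cancel₀ h2 ?_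
    rw [hn]; ring
  have h3 : a = b + n := by exact_mod_cast h1
  have h4 : n < 1 := by
    have : (n : ℚ) < 1 := by linarith
    exact_mod_cast this
  have h5 : -1 < n := by
    have : (-1 : ℚ) < n := by linarith
    exact_mod_cast this
  obtain rfl : n = 0 := by omega
  simpa using h3

theorem map_exp_reducedFractions {d : ℕ} (hd : 0 < d) :
    (reducedFractions d).map (fun a : ℚ => Complex.exp (2 * Real.pi * Complex.I * (a : ℂ))) =
      (primitiveRoots d ℂ).val := by
  refine (Multiset.Nodup.ext (Multiset.Nodup.map_on (fun a ha b hb h =>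
    exp_two_pi_mul_I_injOn (mem_reducedFractions_bounds ha) (mem_reducedFractions_bounds hb) h)
    (reducedFractions_nodup d)) (Finset.nodup _)).mpr fun z => ?_
  rw [Finset.mem_val, mem_primitiveRoots hd, Multiset.mem_map]
  constructor
  · rintro ⟨a, ha, rfl⟩
    have h := Complex.isPrimitiveRoot_exp_rat a
    rwa [den_of_mem_reducedFractions ha] at h
  · intro hz
    obtain ⟨i, hi, hc, rfl⟩ := (Complex.isPrimitiveRoot_iff z d hd.ne').mp hz
    rcases Nat.eq_zero_or_pos i with rfl | hi0
    · obtain rfl : d = 1 := by simpa using hc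
      exact ⟨1, by simpa using one_div_mem_reducedFractions one_pos, by simp⟩
    · exact ⟨(i : ℚ) / d, reducedFractions_mem.mpr ⟨i, ⟨hi0, hi.le⟩, hc, rfl⟩, by push_cast; rfl⟩

theorem prod_X_sub_C_exp_reducedFractions {d : ℕ} (hd : 0 < d) :
    ((reducedFractions d).map fun a : ℚ => Polynomial.X -
      Polynomial.C (Complex.exp (2 * Real.pi * Complex.I * (a : ℂ)))).prod =
      Polynomial.cyclotomic d ℂ := by
  rw [Polynomial.cyclotomic_eq_prod_X_sub_primitiveRoots
    (Complex.isPrimitiveRoot_exp d hd.ne'), Finset.prod, ← map_exp_reducedFractions hd,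
    Multiset.map_map]
  rfl

theorem roots_prod_X_sub_C_exp (α : Multiset ℚ) :
    (α.map fun a : ℚ => Polynomial.X -
      Polynomial.C (Complex.exp (2 * Real.pi * Complex.I * (a : ℂ)))).prod.roots =
      α.map fun a : ℚ => Complex.exp (2 * Real.pi * Complex.I * (a : ℂ)) := by
  have h := Polynomial.roots_multiset_prod_X_sub_C
    (α.map fun a : ℚ => Complex.exp (2 * Real.pi * Complex.I * (a : ℂ)))
  rwa [Multiset.map_map] at h

/-- A Galois closed multiset of rational numbers in `(0, 1]` is a union of sets `Σ_d`. -/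
theorem IsGaloisClosed.exists_eq_sum_reducedFractions {α : Multiset ℚ} (hgal : IsGaloisClosed α)
    (hnorm : ∀ a ∈ α, 0 < a ∧ a ≤ 1) :
    ∃ D : Multiset ℕ, (∀ d ∈ D, 0 < d) ∧ (D.map reducedFractions).sum = α := by
  induction hc : Multiset.card α using Nat.strong_induction_on generalizing α with
  | _ m ih =>
  rcases Multiset.empty_or_exists_mem α with rfl | ⟨a, ha⟩
  · exact ⟨0, by simp, by simp⟩
  obtain ⟨P, hP⟩ := hgal
  have hd := a.den_pos
  have hroots : (P.map (Int.castRingHom ℂ)).roots =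
      α.map fun a : ℚ => Complex.exp (2 * Real.pi * Complex.I * (a : ℂ)) := by
    rw [hP, roots_prod_X_sub_C_exp]
  have hP0 : P.map (Int.castRingHom ℂ) ≠ 0 := by
    rw [hP]
    refine Multiset.prod_ne_zero fun h => ?_
    obtain ⟨b, -, hb⟩ := Multiset.mem_map.mp h
    exact Polynomial.X_sub_C_ne_zero _ hb
  obtain ⟨Q, rfl⟩ : Polynomial.cyclotomic a.den ℤ ∣ P := by
    have hprim := Complex.isPrimitiveRoot_exp_rat a
    rw [Polynomial.cyclotomic_eq_minpoly hprim hd]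
    refine minpoly.isIntegrallyClosed_dvd (hprim.isIntegral hd) ?_
    have h : Complex.exp (2 * Real.pi * Complex.I * (a : ℂ)) ∈
        (P.map (Int.castRingHom ℂ)).roots := by
      rw [hroots]; exact Multiset.mem_map_of_mem _ ha
    rw [Polynomial.aeval_def, ← Polynomial.eval_map]
    exact (Polynomial.mem_roots'.mp h).2
  rw [Polynomial.map_mul, Polynomial.map_cyclotomic] at hP hP0 hroots
  have hle : reducedFractions a.den ≤ α := by
    refine (Multiset.le_iff_subset (reducedFractions_nodup _)).mpr fun b hb => ?_
    have h : Complex.exp (2 * Real.pi * Complex.I * (b : ℂ)) ∈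
        α.map fun a : ℚ => Complex.exp (2 * Real.pi * Complex.I * (a : ℂ)) := by
      rw [← hroots, Polynomial.roots_mul hP0, ← prod_X_sub_C_exp_reducedFractions hd]
      refine Multiset.mem_add.mpr (Or.inl ?_)
      rw [roots_prod_X_sub_C_exp]
      exact Multiset.mem_map_of_mem _ hb
    obtain ⟨c, hcα, hcb⟩ := Multiset.mem_map.mp h
    rwa [← exp_two_pi_mul_I_injOn (hnorm c hcα) (mem_reducedFractions_bounds hb) hcb]
  obtain ⟨γ, rfl⟩ := Multiset.le_iff_exists_add.mp hle
  rw [Multiset.map_add, Multiset.prod_add, prod_X_sub_C_exp_reducedFractions hd] at hP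
  have hpos : 0 < Multiset.card (reducedFractions a.den) :=
    Multiset.card_pos_iff_exists_mem.mpr ⟨_, one_div_mem_reducedFractions hd⟩
  obtain ⟨D, hD, rfl⟩ := ih (Multiset.card γ) (by rw [← hc, Multiset.card_add]; omega)
    ⟨Q, mul_left_cancel₀ (Polynomial.cyclotomic_ne_zero _ ℂ) hP⟩
    (fun b hb => hnorm b (Multiset.mem_add.mpr (Or.inr hb))) rfl
  refine ⟨a.den ::ₘ D, ?_, by simp⟩
  rintro d hd'
  rcases Multiset.mem_cons.mp hd' with rfl | h
  · exact hd
  · exact hD d h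

end GaloisClosure

theorem Multiset.prod_map_prod_map_eq {ι κ M : Type*} [CommMonoid M] (s : Multiset ι)
    (t : ι → Multiset κ) (f : κ → M) :
    (s.map fun i => ((t i).map f).prod).prod = (((s.map t).sum).map f).prod := by
  induction s using Multiset.induction_on with
  | empty => simp
  | cons i s ih => simp [ih]

theorem prod_map_gammaFactor (p : ℕ) [hp : Fact p.Prime] (k : ℕ) (α : Multiset ℚ) :
    (α.map (gammaFactor p k)).prod =
      1 / (α.map fun a : ℚ => padicGammaRat p a).prod *
        ((α.map fun a : ℚ => padicGammaRat p (Int.fract (a - (k : ℚ) / ((p : ℚ) - 1)))).prod /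
            padicGammaRat p (1 - (k : ℚ) / ((p : ℚ) - 1)) ^ Multiset.card α *
          (-1) ^ (k * Multiset.card α) * (-(p : ℂ_[p])) ^ hypNuMultiset p α k) := by
  induction α using Multiset.induction_on with
  | empty => simp [hypNuMultiset]
  | cons a α ih =>
    have h : hypNuMultiset p (a ::ₘ α) k =
        hypNu p k (a * ((p : ℚ) - 1)) + hypNuMultiset p α k := by simp [hypNuMultiset]
    rw [Multiset.map_cons, Multiset.prod_cons, ih, h, zpow_add₀ (prime_ne_zero_complex p),
      gammaFactor]
    simp only [Multiset.map_cons, Multiset.prod_cons, Multiset.card_cons, pow_succ, mul_add,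
      mul_one, pow_add, div_eq_mul_inv, mul_inv, one_mul]
    ring

theorem mainTheorem5 (p : ℕ) [Fact p.Prime] (θ : AddChar (ZMod p) ℂ_[p]) (hθ : θ ≠ 1)
    (lam : ℚ) (hlam : lam ≠ 0) (α : Multiset ℚ)
    (hnorm : ∀ a ∈ α, 0 < a ∧ a ≤ 1)
    (hgal : IsGaloisClosed α)
    (hprim : IsPrimitiveData α (Multiset.replicate (Multiset.card α) 1))
    (hp : ∀ a ∈ α, ¬ p ∣ a.den) :
    finiteHypergeometricSum θ (teichmullerChar p) α (lam : ZMod p) =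
      1 / (α.map fun a : ℚ => padicGammaRat p a).prod * (1 / (1 - (p : ℂ_[p]))) *
        ∑ k ∈ Finset.range (p - 1),
          (α.map fun a : ℚ => padicGammaRat p (Int.fract (a - (k : ℚ) / ((p : ℚ) - 1)))).prod /
              padicGammaRat p (1 - (k : ℚ) / ((p : ℚ) - 1)) ^ Multiset.card α *
            (-1) ^ (k * Multiset.card α) * (-(p : ℂ_[p])) ^ hypNuMultiset p α k *
            (teichmullerChar p ^ k) ((-1) ^ Multiset.card α * (lam : ZMod p)) := by
  obtain ⟨D, hD, rfl⟩ := hgal.exists_eq_sum_reducedFractions hnorm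
  have hmem : ∀ d ∈ D, ∀ a ∈ reducedFractions d, a ∈ (D.map reducedFractions).sum := by
    intro d hd a ha
    obtain ⟨E, rfl⟩ := Multiset.exists_cons_of_mem hd
    rw [Multiset.map_cons, Multiset.sum_cons]
    exact Multiset.mem_add.mpr (Or.inl ha)
  have hD1 : ∀ d ∈ D, 1 < d := by
    intro d hd
    have h0 := hD d hd
    by_contra h1
    obtain rfl : d = 1 := by omega
    have h := hmem 1 hd _ (one_div_mem_reducedFractions one_pos)
    refine hprim _ h 1 (Multiset.mem_replicate.mpr ⟨?_, rfl⟩) 0 (by simp)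
    exact (Multiset.card_pos_iff_exists_mem.mpr ⟨_, h⟩).ne'
  have hDp : ∀ d ∈ D, ¬ p ∣ d := by
    intro d hd
    have h := one_div_mem_reducedFractions (hD d hd)
    have h' := hp _ (hmem d hd _ h)
    rwa [den_of_mem_reducedFractions h] at h'
  have hS : ∀ k < p - 1, (D.map fun d : ℕ => gaussSumS θ d (teichmullerChar p ^ k)).prod =
      ((D.map reducedFractions).sum.map (gammaFactor p k)).prod := by
    intro k hk
    rw [← Multiset.prod_map_prod_map_eq]
    exact congrArg Multiset.prod (Multiset.map_congr rfl fun d hd =>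
      gaussSumS_eq_prod_gammaFactor p hθ hk (hD1 d hd) (hDp d hd))
  rw [finiteHypergeometricSum, cyclotomicIndices_eq D hD, ZMod.card, mul_comm (1 / _) (1 / _),
    mul_assoc, Finset.mul_sum (a := 1 / Multiset.prod _)]
  congr 1
  refine Finset.sum_congr rfl fun k hk => ?_
  rw [hS k (Finset.mem_range.mp hk), prod_map_gammaFactor]
  ring
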